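/- Let $E$ be an exceptional prime divisor over $0\in\mathbb{C}^2$, i.e. one that appears after a finite sequence $\mu:Y\to\mathbb{C}^2$ of blow-ups of points lying over the origin (for example a component of $\mu^{-1}(0)$ for the minimal $m$-separating log resolution $\mu$ of a plane curve germ). Its log discrepancy is $\nu_E=\operatorname{ord}_E(K_{Y/\mathbb{C}^2})+1$. The Newton pairs of $E$ are defined as follows. Let $\tilde D$ be a (formal) germ of a smooth curve on $Y$ that intersects $E$ transversely and meets no other exceptional divisor, and let $D=\mu(\tilde D)$, an irreducible plane curve germ. Choose formal coordinates $(x_0,y_0)$ at $0\in\mathbb{C}^2$ such that $\{y_0=0\}$ has the same tangent direction as $D$, and parametrize $D$ as $(\tau^{r_1},\varphi(\tau))$ with $r_1=\operatorname{mult}(D)$ and $\varphi=\sum_k\varphi_k\tau^k$. Put $k_0=0$ and, inductively for $i\ge 1$, $$k_i=\min\{k \mid \varphi_k\neq 0,\ r_i\nmid k\},\qquad r_{i+1}=\gcd(k_i,r_i),$$ and let $g$ be the first integer $\geq 0$ with $k_{g+1}=\infty$; then $r_{g+1}=1$. Put $\kappa_i=k_i-k_{i-1}$. The Newton pairs of $D$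 are $(\hat\kappa_i,\hat r_i)=(\kappa_i/r_{i+1},\,r_i/r_{i+1})$, $i=1,\dots,g$. If $E$ is the last exceptional divisor of the minimal embedded resolution of $D$, then $g^E=g$ and $k_i^E$, $r_i^E$, $(\hat\kappa_i^E,\hat r_i^E)$ are these data of $D$. Otherwise $E$ is obtained from the minimal embedded resolution of $D$ (which is the identity if $D$ is smooth) by $s\ge 1$ further blow-ups, each of the point of the strict transform of $D$ over $0$; then $g^E=g+1$, one more Newton pair $(\hat\kappa^E_{g+1},\hat r^E_{g+1})=(s,1)$ is added at the end, and correspondingly $k^E_{g+1}=k_g+s$, $r^E_{g+2}=1$, all other data being those of $D$. **Proposition 2.5 (log discrepancies).** For every such $E$, and for every choice of $\tilde D$ and of the coordinates $(x_0,y_0)$, $$\nu_E=k^E_{g^E}+r^E_1 .$$ -/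

import Mathlib

open scoped PowerSeries Topology

noncomputable section

namespace PlaneCurve

/-- The chart of the blow-up of the origin of a plane with coordinates `(u, v)`, centred at the point
of the exceptional curve `ℙ¹ = ℂ ∪ {∞}` that is given by a tangent direction: the direction
`v = c u` for `c : ℂ`, the direction `u = 0` for `∞`.
In the new coordinates `(u', v')` the blow-up is `(u, v) = (u', u' (v' + c))`, respectively
`(u, v) = (u' v', u')`; in both cases the exceptional curve is `u' = 0` and the chosen point is the
origin.  The formula makes sense on points with coordinates in any commutative `ℂ`-algebra `A`:
complex points, arcs (`A = ℂ⟦X⟧`), and the generic point (`A` a polynomial ring). -/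
def blowUpChart {A : Type*} [CommRing A] [Algebra ℂ A] : OnePoint ℂ → A × A → A × A
  | OnePoint.infty, z => (z.1 * z.2, z.1)
  | OnePoint.some c, z => (z.1, z.1 * (z.2 + algebraMap ℂ A c))

/-- A list `[d₁, …, dₙ]` of directions encodes a sequence of infinitely near points of
`p₀ = 0 ∈ ℂ²`: `p₁` is the point `d₁` of the exceptional curve `E₁` of the blow-up of `p₀`,
`p₂` is the point `d₂` of the exceptional curve `E₂` of the blow-up of `p₁`, and so on.  This is the
composition of the blow-ups of `p₀, …, pₙ₋₁`, from the chart centred at `pₙ` to `ℂ²`. If `n ≥ 1`,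
the last exceptional curve `Eₙ` is `u = 0` in this chart. -/
def blowUpMap {A : Type*} [CommRing A] [Algebra ℂ A] : List (OnePoint ℂ) → A × A → A × A
  | [], z => z
  | d :: l, z => blowUpChart d (blowUpMap l z)

/-- The point `pₙ` of the last exceptional curve `Eₙ` lies on no other exceptional curve: near `pₙ`
the fibre over the origin is contained in `Eₙ`. -/
def IsFreePoint (l : List (OnePoint ℂ)) : Prop :=
  ∀ᶠ z in 𝓝 ((0, 0) : ℂ × ℂ), blowUpMap l z = (0, 0) → z.1 = 0

/-- An exceptional prime divisor over `0 ∈ ℂ²`, i.e. one that appears after a finite sequence of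
blow-ups of points over the origin.  It is given by the points that have to be blown up after the
origin until it appears: `centers = [d₁, …, dₘ]` stands for the exceptional curve `Eₘ₊₁` of the
blow-up of the last point `pₘ` (for the empty list, of the blow-up of the origin). -/
structure ExceptionalDivisor where
  centers : List (OnePoint ℂ)

namespace ExceptionalDivisor

/-- The number of blow-ups needed for the divisor to appear. -/
def level (E : ExceptionalDivisor) : ℕ := E.centers.length + 1

/-- The two components, in `ℂ[u, v]`, of the composition of blow-ups in an affine chart that
contains all points but one of the divisor, which is `u = 0`. -/
def chartMap (E : ExceptionalDivisor) : MvPolynomial (Fin 2) ℂ × MvPolynomial (Fin 2) ℂ :=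
  blowUpMap (E.centers ++ [((0 : ℂ) : OnePoint ℂ)]) (MvPolynomial.X 0, MvPolynomial.X 1)

/-- The Jacobian determinant of the composition of blow-ups: a local equation of the relative
canonical divisor. -/
def jacobian (E : ExceptionalDivisor) : MvPolynomial (Fin 2) ℂ :=
  MvPolynomial.pderiv 0 E.chartMap.1 * MvPolynomial.pderiv 1 E.chartMap.2
    - MvPolynomial.pderiv 1 E.chartMap.1 * MvPolynomial.pderiv 0 E.chartMap.2

/-- The log discrepancy: the order of vanishing along the divisor `u = 0` of the relative canonical
divisor, plus one. -/
def logDiscrepancy (E : ExceptionalDivisor) : ℕ∞ :=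
  emultiplicity (MvPolynomial.X 0) E.jacobian + 1

/-- A parametrized formal germ of a smooth curve on the blown-up surface, that intersects `E`
transversely at a point of `E` and meets no other exceptional divisor.  In the chart centred at that
point, where `E` is `u = 0`, the curve is `τ ↦ (u(τ), v(τ))`. -/
structure Curvette (E : ExceptionalDivisor) where
  point : OnePoint ℂ
  isFree : IsFreePoint (E.centers ++ [point])
  u : ℂ⟦X⟧
  v : ℂ⟦X⟧
  order_u : u.order = 1
  constantCoeff_v : PowerSeries.constantCoeff v = 0

namespace Curvette

variable {E : ExceptionalDivisor}

/-- The directions of all infinitely near points up to the point where the curve meets `E`. -/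
def directions (D : E.Curvette) : List (OnePoint ℂ) := E.centers ++ [D.point]

/-- The strict transform of the blown-down curve after the first `i` blow-ups, parametrized in the
chart centred at the point `pᵢ`. -/
def strictTransform (D : E.Curvette) (i : ℕ) : ℂ⟦X⟧ × ℂ⟦X⟧ :=
  blowUpMap (D.directions.drop i) (D.u, D.v)

/-- The blow-down of the curve: a parametrized irreducible plane curve germ. -/
def blowDown (D : E.Curvette) : ℂ⟦X⟧ × ℂ⟦X⟧ := D.strictTransform 0

/-- The first `i` blow-ups are an embedded resolution of the blown-down curve: its strict transform
is smooth and, if `i ≥ 1`, it meets `Eᵢ` transversely and no other exceptional curve. -/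
def IsResolvedAt (D : E.Curvette) (i : ℕ) : Prop :=
  (i = 0 ∧ ((D.strictTransform 0).1.order = 1 ∨ (D.strictTransform 0).2.order = 1)) ∨
  (0 < i ∧ (D.strictTransform i).1.order = 1 ∧ IsFreePoint (D.directions.take i))

/-- The number of blow-ups in the minimal embedded resolution of the blown-down curve. -/
def resolutionLength (D : E.Curvette) : ℕ := sInf {i | D.IsResolvedAt i}

/-- The number of blow-ups that lead from the minimal embedded resolution of the blown-down curve
to the divisor `E`. -/
def extraBlowUps (D : E.Curvette) : ℕ := E.level - D.resolutionLength

end Curvette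

end ExceptionalDivisor

/-- `h(γ(τ))` for a power series `h` in two variables and a parametrized curve `γ` through `0`. -/
def substCurve (h : MvPowerSeries (Fin 2) ℂ) (γ : ℂ⟦X⟧ × ℂ⟦X⟧) : ℂ⟦X⟧ :=
  MvPowerSeries.subst (![γ.1, γ.2] : Fin 2 → MvPowerSeries Unit ℂ) h

/-- Formal coordinates `(x₀, y₀)` of the plane at the origin in which the parametrized branch `γ`
takes the form `(τ ^ mult, φ(τ))`, where the curve `y₀ = 0` has the same tangent direction as the
branch (that is, `ord φ > mult`, and so `mult` is the multiplicity of the branch). -/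
structure PuiseuxCoordinates (γ : ℂ⟦X⟧ × ℂ⟦X⟧) where
  x₀ : MvPowerSeries (Fin 2) ℂ
  y₀ : MvPowerSeries (Fin 2) ℂ
  constantCoeff_x₀ : MvPowerSeries.constantCoeff x₀ = 0
  constantCoeff_y₀ : MvPowerSeries.constantCoeff y₀ = 0
  linear_part_invertible :
    MvPowerSeries.coeff (Finsupp.single 0 1) x₀ * MvPowerSeries.coeff (Finsupp.single 1 1) y₀
      - MvPowerSeries.coeff (Finsupp.single 1 1) x₀ * MvPowerSeries.coeff (Finsupp.single 0 1) y₀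
      ≠ 0
  mult : ℕ
  x₀_eq : substCurve x₀ γ = PowerSeries.X ^ mult
  tangent : (mult : ℕ∞) < (substCurve y₀ γ).order

/-- The power series `φ(τ) = y₀(γ(τ))`. -/
def PuiseuxCoordinates.φ {γ : ℂ⟦X⟧ × ℂ⟦X⟧} (P : PuiseuxCoordinates γ) : ℂ⟦X⟧ := substCurve P.y₀ γ

/-- `min {k | φₖ ≠ 0 and d does not divide k}`, which is `∞` if there is no such `k`. -/
def minExponent (φ : ℂ⟦X⟧) (d : ℕ) : ℕ∞ :=
  ⨅ k ∈ {k : ℕ | PowerSeries.coeff k φ ≠ 0 ∧ ¬ d ∣ k}, (k : ℕ∞)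

/-- The integers `r₁ = n` and `rᵢ₊₁ = gcd(kᵢ, rᵢ)`, where `kᵢ` is the `i`-th characteristic exponent
of `(τ ^ n, φ(τ))`.  (The value at `i = 0` plays no role.) -/
def charGcd (n : ℕ) (φ : ℂ⟦X⟧) : ℕ → ℕ
  | 0 => 0
  | 1 => n
  | i + 2 => Nat.gcd (minExponent φ (charGcd n φ (i + 1))).toNat (charGcd n φ (i + 1))

/-- The characteristic exponents `kᵢ = min {k | φₖ ≠ 0 and rᵢ does not divide k}` for `i ≥ 1`, and
`k₀ = 0`. -/
def charExponent (n : ℕ) (φ : ℂ⟦X⟧) (i : ℕ) : ℕ∞ :=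
  if i = 0 then 0 else minExponent φ (charGcd n φ i)

/-- The numerical data that go with a finite sequence of Newton pairs: their number `g`, the numbers
`r₁, …, r_{g+1}` and the numbers `k₀ = 0, k₁, …, k_g`. -/
structure NewtonData where
  g : ℕ
  r : ℕ → ℕ
  k : ℕ → ℕ

/-- `κ₁ = k₁` and `κᵢ = kᵢ - kᵢ₋₁`. -/
def NewtonData.κ (N : NewtonData) (i : ℕ) : ℕ := N.k i - N.k (i - 1)

/-- The `i`-th Newton pair `(κᵢ / rᵢ₊₁, rᵢ / rᵢ₊₁)`, for `1 ≤ i ≤ g`. -/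
def NewtonData.newtonPair (N : NewtonData) (i : ℕ) : ℕ × ℕ :=
  (N.κ i / N.r (i + 1), N.r i / N.r (i + 1))

/-- The data of the branch parametrized by `(τ ^ n, φ(τ))`; here `g` is the first integer such that
`k_{g+1} = ∞`. -/
def branchNewtonData (n : ℕ) (φ : ℂ⟦X⟧) : NewtonData where
  g := sInf {g | charExponent n φ (g + 1) = ⊤}
  r := charGcd n φ
  k i := (charExponent n φ i).toNat

/-- For data with `r_{g+1} = 1`: add the Newton pair `(s, 1)` at the end, that is,
`κ_{g+1} = s` and `r_{g+2} = 1`. -/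
def NewtonData.append (N : NewtonData) (s : ℕ) : NewtonData where
  g := N.g + 1
  r i := if i ≤ N.g + 1 then N.r i else 1
  k i := if i ≤ N.g then N.k i else N.k N.g + s

/-- The Newton data of the divisor `E`, computed from a smooth curve transverse to `E` and from
coordinates adapted to its blow-down.  They are the data of the blown-down curve if `E` is the last
exceptional divisor of the minimal embedded resolution of that curve.  Otherwise `E` arises from
this resolution by `s ≥ 1` further blow-ups of the point of the strict transform, and the
last Newton pair of `E` is `(s, 1)`. -/
def ExceptionalDivisor.newtonData (E : ExceptionalDivisor) (D : E.Curvette)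
    (P : PuiseuxCoordinates D.blowDown) : NewtonData :=
  if D.extraBlowUps = 0 then branchNewtonData P.mult P.φ
  else (branchNewtonData P.mult P.φ).append D.extraBlowUps

end PlaneCurve

end

/-!
The proof compares both sides with the multiplicities of the strict transforms of the branch
`D = μ(D̃)` at the points that are blown up.

The Jacobian of a chart of a blow-up is, up to sign, the equation `u` of its exceptional curve.  So
`ord_E(K)` is the sum of the orders along `E` of the exceptional equations of all blow-ups, pulled
back to `Y`.  These orders can be read off along a curvette `D̃`, and the order of `u` along a
strict transform of `D` is its multiplicity at the point that is blown up. Hence `ν_E` is one more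
than the sum of the multiplicities (`logDiscrepancy_eq`).

The multiplicities are governed by the contact of `D` with its conjugates.  For a parametrization
`(a, b)` one asks for series `σ` with `σ(0) = 0`, `σ'(0) ≠ 1` and `a ∘ σ = a`, and for the maximal
order `K` of `b ∘ σ - b` (`HasConjugate`).  If `a = τ ^ n`, then `σ = ζ τ` with `ζ ^ n = 1`, and `K`
is the last characteristic exponent `k_g` (`branchNewtonData_k_g`).  A blow-up `(a, a (b + c))` of
`(a, b)` adds `n = ord a`, the multiplicity, to `K` (`hasConjugate_mul_add_iff`).  The blow-up in
the infinite direction needs moreover the inversion formula `K + ord a = K' + ord b`, where `K'` is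
the maximal contact after exchanging `a` and `b` (`hasConjugate_swap`). It follows by correcting
`σ`: as `a` is the `n`-th power of a uniformizer, a series that preserves `a` up to higher order is
close to one that preserves `a` exactly (`exists_subst_eq_self`).  Induction on the number of
blow-ups, with one formula for free and one for satellite points, shows that the multiplicities up
to the minimal embedded resolution add up to `K + n - 1` (`contactFormula`); each further
blow-up contributes `1`.

Finally, the arcs `γ` and `γ ∘ σ` agree to the same order in all formal coordinate systems
(`X_pow_dvd_substCurve_sub_iff`), which makes the comparison independent of the choice of
`(x₀, y₀)`.
-/

open scoped PowerSeries Topology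

namespace PlaneCurve

/-! ### Substitution of power series modulo powers of the variable -/

/-- Substitution is continuous for the `X`-adic topology. -/
theorem X_pow_dvd_subst_sub_subst {σ σ' : ℂ⟦X⟧} (hσ : PowerSeries.constantCoeff σ = 0)
    (hσ' : PowerSeries.constantCoeff σ' = 0) {k : ℕ} (h : PowerSeries.X ^ k ∣ σ - σ')
    (a : ℂ⟦X⟧) : (PowerSeries.X : ℂ⟦X⟧) ^ k ∣ (a.subst σ : ℂ⟦X⟧) - a.subst σ' := by
  rw [PowerSeries.X_pow_dvd_iff]
  intro m hm
  rw [map_sub, sub_eq_zero,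
    PowerSeries.coeff_subst' (PowerSeries.HasSubst.of_constantCoeff_zero' hσ),
    PowerSeries.coeff_subst' (PowerSeries.HasSubst.of_constantCoeff_zero' hσ')]
  refine finsum_congr fun d => ?_
  have h1 := PowerSeries.X_pow_dvd_iff.mp (h.trans (sub_dvd_pow_sub_pow σ σ' d)) m hm
  rw [map_sub, sub_eq_zero] at h1
  rw [h1]

/-- A series of order at least `n + 1` gains `n` in the precision of its argument. -/
theorem X_pow_dvd_subst_sub_subst_of_dvd {σ σ' : ℂ⟦X⟧} (hσ : PowerSeries.constantCoeff σ = 0)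
    (hσ' : PowerSeries.constantCoeff σ' = 0) {k : ℕ} (h : PowerSeries.X ^ k ∣ σ - σ')
    {a : ℂ⟦X⟧} {n : ℕ} (ha : PowerSeries.X ^ (n + 1) ∣ a) :
    (PowerSeries.X : ℂ⟦X⟧) ^ (n + k) ∣ (a.subst σ : ℂ⟦X⟧) - a.subst σ' := by
  have hs := PowerSeries.HasSubst.of_constantCoeff_zero' hσ
  have hs' := PowerSeries.HasSubst.of_constantCoeff_zero' hσ'
  obtain ⟨A, rfl⟩ := ha
  obtain ⟨c, rfl⟩ := PowerSeries.X_dvd_iff.mpr hσ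
  obtain ⟨c', rfl⟩ := PowerSeries.X_dvd_iff.mpr hσ'
  have h1 := X_pow_dvd_subst_sub_subst hσ hσ' h A
  rw [PowerSeries.subst_mul hs, PowerSeries.subst_mul hs', PowerSeries.subst_pow hs,
    PowerSeries.subst_pow hs', PowerSeries.subst_X hs, PowerSeries.subst_X hs']
  set B := (A.subst (PowerSeries.X * c) : ℂ⟦X⟧)
  set B' := (A.subst (PowerSeries.X * c') : ℂ⟦X⟧)
  have e : (PowerSeries.X * c) ^ (n + 1) * B - (PowerSeries.X * c') ^ (n + 1) * B'
      = ((PowerSeries.X * c) ^ (n + 1) - (PowerSeries.X * c') ^ (n + 1)) * B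
        + (PowerSeries.X * c') ^ (n + 1) * (B - B') := by ring
  rw [e]
  refine dvd_add (Dvd.dvd.mul_right ?_ _) ?_
  · have e2 : (PowerSeries.X * c) ^ (n + 1) - (PowerSeries.X * c') ^ (n + 1)
        = PowerSeries.X ^ n * (PowerSeries.X * (c ^ (n + 1) - c' ^ (n + 1))) := by ring
    rw [e2, pow_add]
    refine mul_dvd_mul_left _ (h.trans ?_)
    rw [← mul_sub]
    exact mul_dvd_mul_left _ (sub_dvd_pow_sub_pow _ _ _)
  · rw [mul_pow, mul_assoc, pow_add]
    refine mul_dvd_mul (pow_dvd_pow _ (Nat.le_succ n)) (Dvd.dvd.mul_left h1 _)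

theorem constantCoeff_subst_eq_zero' {σ a : ℂ⟦X⟧} (hσ : PowerSeries.constantCoeff σ = 0)
    (ha : PowerSeries.constantCoeff a = 0) :
    PowerSeries.constantCoeff (a.subst σ : ℂ⟦X⟧) = 0 :=
  PowerSeries.constantCoeff_subst_eq_zero hσ a ha

theorem X_pow_dvd_subst {σ a : ℂ⟦X⟧} (hσ : PowerSeries.constantCoeff σ = 0) {n : ℕ}
    (ha : PowerSeries.X ^ n ∣ a) : (PowerSeries.X : ℂ⟦X⟧) ^ n ∣ a.subst σ := by
  have hs := PowerSeries.HasSubst.of_constantCoeff_zero' hσ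
  obtain ⟨A, rfl⟩ := ha
  rw [PowerSeries.subst_mul hs, PowerSeries.subst_pow hs, PowerSeries.subst_X hs]
  exact Dvd.dvd.mul_right (pow_dvd_pow_of_dvd (PowerSeries.X_dvd_iff.mpr hσ) n) _

theorem X_pow_dvd_iff_le_order {a : ℂ⟦X⟧} {n : ℕ} :
    (PowerSeries.X : ℂ⟦X⟧) ^ n ∣ a ↔ (n : ℕ∞) ≤ a.order := by
  rw [PowerSeries.order_eq_emultiplicity_X, pow_dvd_iff_le_emultiplicity]

theorem exists_eq_X_pow_mul_of_order_eq {a : ℂ⟦X⟧} {n : ℕ} (ha : a.order = n) :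
    ∃ w : ℂ⟦X⟧, a = PowerSeries.X ^ n * w ∧ PowerSeries.constantCoeff w ≠ 0 := by
  obtain ⟨w, rfl⟩ := X_pow_dvd_iff_le_order.mpr ha.ge
  refine ⟨w, rfl, fun h => ?_⟩
  obtain ⟨w', rfl⟩ := PowerSeries.X_dvd_iff.mpr h
  have : PowerSeries.X ^ (n + 1) ∣ PowerSeries.X ^ n * (PowerSeries.X * w') :=
    ⟨w', by ring⟩
  rw [X_pow_dvd_iff_le_order, ha] at this
  norm_cast at this
  omega

/-! ### Uniformizers and deck transformations -/

/-- A power series over `ℂ` with nonzero constant coefficient has an `n`-th root: the binomial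
series. -/
theorem exists_pow_eq_of_constantCoeff_ne_zero {w : ℂ⟦X⟧} (hw : PowerSeries.constantCoeff w ≠ 0)
    {n : ℕ} (hn : n ≠ 0) : ∃ v : ℂ⟦X⟧, v ^ n = w := by
  obtain ⟨c, hc⟩ := IsAlgClosed.exists_pow_nat_eq (PowerSeries.constantCoeff w)
    (Nat.pos_of_ne_zero hn)
  set f : ℂ⟦X⟧ := PowerSeries.C (PowerSeries.constantCoeff w)⁻¹ * w - 1 with hf
  have hf0 : PowerSeries.constantCoeff f = 0 := by simp [hf, hw]
  have hs := PowerSeries.HasSubst.of_constantCoeff_zero' hf0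
  set B : ℂ⟦X⟧ := PowerSeries.binomialSeries ℂ ((n : ℚ)⁻¹) with hB
  have hBpow : ∀ m : ℕ, B ^ m = PowerSeries.binomialSeries ℂ (m * (n : ℚ)⁻¹) := by
    intro m
    induction m with
    | zero => simp
    | succ m ih => rw [pow_succ, ih, hB, ← PowerSeries.binomialSeries_add]; push_cast; ring_nf
  have hBn : B ^ n = 1 + PowerSeries.X := by
    rw [hBpow, mul_inv_cancel₀ (by exact_mod_cast hn)]
    simpa using PowerSeries.binomialSeries_nat (R := ℚ) (A := ℂ) 1
  refine ⟨PowerSeries.C c * B.subst f, ?_⟩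
  have h1 : (1 : ℂ⟦X⟧).subst f = (1 : ℂ⟦X⟧) := by
    rw [← PowerSeries.coe_substAlgHom hs, map_one]
  rw [mul_pow, ← PowerSeries.subst_pow hs, hBn, PowerSeries.subst_add hs, h1,
    PowerSeries.subst_X hs, hf, ← map_pow, hc, add_sub_cancel, ← mul_assoc, ← map_mul,
    mul_inv_cancel₀ hw, map_one, one_mul]

/-- Two series with the same nonzero constant coefficient are as close as their `n`-th powers. -/
theorem dvd_sub_of_dvd_pow_sub_pow {f u v : ℂ⟦X⟧} {n : ℕ} (hn : n ≠ 0)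
    (h0 : PowerSeries.constantCoeff u = PowerSeries.constantCoeff v)
    (hv : PowerSeries.constantCoeff v ≠ 0) (h : f ∣ u ^ n - v ^ n) : f ∣ u - v := by
  rw [← Commute.geom_sum₂_mul (Commute.all _ _)] at h
  refine (IsUnit.dvd_mul_left ?_).mp h
  rw [PowerSeries.isUnit_iff_constantCoeff, isUnit_iff_ne_zero, map_sum]
  have : ∀ i ∈ Finset.range n, PowerSeries.constantCoeff (u ^ i * v ^ (n - 1 - i))
      = PowerSeries.constantCoeff v ^ (n - 1) := by
    intro i hi
    rw [map_mul, map_pow, map_pow, h0, ← pow_add]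
    congr 1
    have := Finset.mem_range.mp hi
    omega
  rw [Finset.sum_congr rfl this, Finset.sum_const, Finset.card_range, nsmul_eq_mul]
  exact mul_ne_zero (Nat.cast_ne_zero.mpr hn) (pow_ne_zero _ hv)

/-- If `σ` preserves a series `a` of order `n` modulo `X ^ (n + t)`, then `σ` agrees
modulo `X ^ (t + 1)` with some `ρ` that preserves `a` exactly.  Indeed `a` is the `n`-th power
of a uniformizer `s`, and `ρ` is the multiplication by an `n`-th root of unity in terms of `s`. -/
theorem exists_subst_eq_self {a σ : ℂ⟦X⟧} {n t : ℕ} (ha : a.order = n) (hn : n ≠ 0) (ht : t ≠ 0)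
    (hσ : PowerSeries.constantCoeff σ = 0)
    (h : PowerSeries.X ^ (n + t) ∣ (a.subst σ : ℂ⟦X⟧) - a) :
    ∃ ρ : ℂ⟦X⟧, PowerSeries.constantCoeff ρ = 0 ∧
      PowerSeries.coeff 1 ρ = PowerSeries.coeff 1 σ ∧ a.subst ρ = a ∧
      PowerSeries.X ^ (t + 1) ∣ ρ - σ := by
  obtain ⟨w, hw, hw0⟩ := exists_eq_X_pow_mul_of_order_eq ha
  obtain ⟨v, rfl⟩ := exists_pow_eq_of_constantCoeff_ne_zero hw0 hn
  have hv0 : PowerSeries.constantCoeff v ≠ 0 := by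
    intro h0; apply hw0; rw [map_pow, h0, zero_pow hn]
  have hsσ := PowerSeries.HasSubst.of_constantCoeff_zero' hσ
  obtain ⟨e, rfl⟩ := PowerSeries.X_dvd_iff.mpr hσ
  set σ : ℂ⟦X⟧ := PowerSeries.X * e with hσdef
  set s : ℂ⟦X⟧ := PowerSeries.X * v with hs
  have hs0 : PowerSeries.constantCoeff s = 0 := by simp [hs]
  have hss := PowerSeries.HasSubst.of_constantCoeff_zero' hs0
  have hs1 : IsUnit (PowerSeries.coeff 1 s) := by
    have : PowerSeries.coeff 1 s = PowerSeries.constantCoeff v := by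
      rw [hs, ← zero_add 1, PowerSeries.coeff_succ_X_mul,
        PowerSeries.coeff_zero_eq_constantCoeff_apply]
    rw [this]; exact hv0.isUnit
  have hsa : a = s ^ n := by rw [hw, hs, mul_pow]
  -- `u` is the series such that `s ∘ σ = X * u`.
  obtain ⟨u, hu⟩ : ∃ u : ℂ⟦X⟧, u = e * v.subst σ := ⟨_, rfl⟩
  have hsσu : s.subst σ = PowerSeries.X * u := by
    rw [hs, PowerSeries.subst_mul hsσ, PowerSeries.subst_X hsσ, hu, hσdef, mul_assoc]
  have hdv : PowerSeries.X ^ t ∣ u ^ n - v ^ n := by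
    rw [hsa, PowerSeries.subst_pow hsσ, hsσu, hs, mul_pow, mul_pow PowerSeries.X v, ← mul_sub,
      pow_add] at h
    exact (mul_dvd_mul_iff_left (pow_ne_zero n PowerSeries.X_ne_zero)).mp h
  set ζ : ℂ := PowerSeries.constantCoeff e with hζ
  have hvσ : PowerSeries.constantCoeff (v.subst σ : ℂ⟦X⟧) = PowerSeries.constantCoeff v := by
    have h1 : PowerSeries.X ^ 1 ∣ σ - 0 := by
      rw [pow_one, sub_zero]; exact PowerSeries.X_dvd_iff.mpr hσ
    have h2 := X_pow_dvd_subst_sub_subst hσ (map_zero _) h1 v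
    rw [pow_one, PowerSeries.X_dvd_iff, map_sub, sub_eq_zero] at h2
    rw [h2, PowerSeries.subst_zero_eq_C_constantCoeff]
    exact MvPowerSeries.constantCoeff_C _
  have hu0 : PowerSeries.constantCoeff u = ζ * PowerSeries.constantCoeff v := by
    rw [hu, map_mul, hvσ]
  have hζn : ζ ^ n = 1 := by
    have h1 := PowerSeries.X_dvd_iff.mp ((dvd_pow_self _ ht).trans hdv)
    rw [map_sub, map_pow, map_pow, hu0, mul_pow, sub_eq_zero] at h1
    exact mul_right_cancel₀ (pow_ne_zero n hv0) (h1.trans (one_mul _).symm)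
  have hζ0 : ζ ≠ 0 := by
    rintro h0; rw [h0, zero_pow hn] at hζn; exact zero_ne_one hζn
  have hdu : PowerSeries.X ^ t ∣ u - PowerSeries.C ζ * v := by
    have e1 : u ^ n - v ^ n = u ^ n - (PowerSeries.C ζ * v) ^ n := by
      rw [mul_pow, ← map_pow, hζn, map_one, one_mul]
    rw [e1] at hdv
    have e2 : PowerSeries.constantCoeff (PowerSeries.C ζ * v)
        = ζ * PowerSeries.constantCoeff v := by
      rw [map_mul, PowerSeries.constantCoeff_C]
    exact dvd_sub_of_dvd_pow_sub_pow hn (hu0.trans e2.symm)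
      (by rw [e2]; exact mul_ne_zero hζ0 hv0) hdv
  -- `T` is the inverse of `s` for composition, and `V = ζ s`.
  set T := s.substInvOfIsUnit hs1 with hT
  have hT1 : s.subst T = PowerSeries.X := PowerSeries.subst_substInvOfIsUnit_right s hs0 hs1
  have hT2 : T.subst s = PowerSeries.X := PowerSeries.subst_substInvOfIsUnit_left s hs0 hs1
  have hTs : PowerSeries.HasSubst T := PowerSeries.HasSubst.substInvOfIsUnit s hs1
  have hT0 : PowerSeries.constantCoeff T = 0 :=
    PowerSeries.constantCoeff_substInvOfIsUnit s hs1
  set V : ℂ⟦X⟧ := PowerSeries.C ζ * s with hV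
  have hV0 : PowerSeries.constantCoeff V = 0 := by rw [hV, map_mul, hs0, mul_zero]
  have hVs := PowerSeries.HasSubst.of_constantCoeff_zero' hV0
  have hρ0 : PowerSeries.constantCoeff (T.subst V : ℂ⟦X⟧) = 0 :=
    constantCoeff_subst_eq_zero' hV0 hT0
  have hρs := PowerSeries.HasSubst.of_constantCoeff_zero' hρ0
  have hdρ : PowerSeries.X ^ (t + 1) ∣ (T.subst V : ℂ⟦X⟧) - σ := by
    have e1 : σ = T.subst (s.subst σ : ℂ⟦X⟧) := by
      rw [← PowerSeries.subst_comp_subst_apply hss hsσ, hT2, PowerSeries.subst_X hsσ]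
    have h0 : PowerSeries.constantCoeff (s.subst σ : ℂ⟦X⟧) = 0 :=
      constantCoeff_subst_eq_zero' hσ hs0
    rw [e1]
    refine X_pow_dvd_subst_sub_subst hV0 h0 ?_ T
    have e2 : V - s.subst σ = -((u - PowerSeries.C ζ * v) * PowerSeries.X) := by
      rw [hsσu, hV, hs]; ring
    rw [e2, dvd_neg, pow_succ]
    exact mul_dvd_mul_right hdu _
  refine ⟨T.subst V, hρ0, ?_, ?_, hdρ⟩
  · have := PowerSeries.X_pow_dvd_iff.mp hdρ 1 (by omega)
    rwa [map_sub, sub_eq_zero] at this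
  · rw [hsa, PowerSeries.subst_pow hρs, ← PowerSeries.subst_comp_subst_apply hTs hVs, hT1,
      PowerSeries.subst_X hVs, hV, mul_pow, ← map_pow, hζn, map_one, one_mul]

/-! ### Conjugate arcs -/

/-- The arc `(a, b)` has a conjugate `(a, b ∘ σ)` over the same `a = a ∘ σ`, different from the arc
in that `σ'(0) ≠ 1`, and the two agree modulo `X ^ K`.  For `a = X ^ n` the conjugates are the
series `b(ζ τ)` with `ζ ^ n = 1`, `ζ ≠ 1`. -/
def HasConjugate (a b : ℂ⟦X⟧) (K : ℕ) : Prop :=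
  ∃ σ : ℂ⟦X⟧, PowerSeries.constantCoeff σ = 0 ∧ PowerSeries.coeff 1 σ ≠ 1 ∧
    a.subst σ = a ∧ PowerSeries.X ^ K ∣ (b.subst σ : ℂ⟦X⟧) - b

/-- The coordinate-free version of `HasConjugate`: the arcs `(a, b)` and `(a ∘ σ, b ∘ σ)` agree
modulo `X ^ N` for some `σ` with `σ'(0) ≠ 1`. -/
def HasApproxConjugate (a b : ℂ⟦X⟧) (N : ℕ) : Prop :=
  ∃ σ : ℂ⟦X⟧, PowerSeries.constantCoeff σ = 0 ∧ PowerSeries.coeff 1 σ ≠ 1 ∧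
    PowerSeries.X ^ N ∣ (a.subst σ : ℂ⟦X⟧) - a ∧ PowerSeries.X ^ N ∣ (b.subst σ : ℂ⟦X⟧) - b

theorem HasApproxConjugate.symm {a b : ℂ⟦X⟧} {N : ℕ} (h : HasApproxConjugate a b N) :
    HasApproxConjugate b a N := by
  obtain ⟨σ, h0, h1, h2, h3⟩ := h
  exact ⟨σ, h0, h1, h3, h2⟩

theorem hasApproxConjugate_comm {a b : ℂ⟦X⟧} {N : ℕ} :
    HasApproxConjugate a b N ↔ HasApproxConjugate b a N :=
  ⟨.symm, .symm⟩

/-- The effect of the blow-up in a finite direction on the contact of conjugate arcs. -/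
theorem hasConjugate_mul_add_iff {a b : ℂ⟦X⟧} {n K : ℕ} (c : ℂ) (ha : a.order = n) :
    HasConjugate a (a * (b + algebraMap ℂ ℂ⟦X⟧ c)) (K + n) ↔ HasConjugate a b K := by
  obtain ⟨w, hw, hw0⟩ := exists_eq_X_pow_mul_of_order_eq ha
  have hwu : IsUnit w := PowerSeries.isUnit_iff_constantCoeff.mpr hw0.isUnit
  refine exists_congr fun σ => and_congr_right fun h0 => and_congr_right fun _ =>
    and_congr_right fun h2 => ?_
  have hs := PowerSeries.HasSubst.of_constantCoeff_zero' h0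
  have hc : (algebraMap ℂ ℂ⟦X⟧ c).subst σ = (algebraMap ℂ ℂ⟦X⟧ c) := by
    rw [← PowerSeries.coe_substAlgHom hs]
    exact (PowerSeries.substAlgHom hs).commutes c
  have e : ((a * (b + algebraMap ℂ ℂ⟦X⟧ c)).subst σ : ℂ⟦X⟧) - a * (b + algebraMap ℂ ℂ⟦X⟧ c)
      = PowerSeries.X ^ n * (w * ((b.subst σ : ℂ⟦X⟧) - b)) := by
    rw [PowerSeries.subst_mul hs, PowerSeries.subst_add hs, hc, h2]
    nth_rw 1 2 [hw]
    ring
  rw [e, add_comm, pow_add, mul_dvd_mul_iff_left (pow_ne_zero n PowerSeries.X_ne_zero),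
    hwu.dvd_mul_left]

/-- If `b` vanishes to the order of `a` at least, then an approximate conjugate can be corrected
to a conjugate with the same precision. -/
theorem hasConjugate_of_dvd {a b σ : ℂ⟦X⟧} {n m t : ℕ} (ha : a.order = n) (hn : n ≠ 0)
    (hm : m ≠ 0) (hb : PowerSeries.X ^ m ∣ b) (ht : t ≠ 0)
    (hσ : PowerSeries.constantCoeff σ = 0) (hσ1 : PowerSeries.coeff 1 σ ≠ 1)
    (h : PowerSeries.X ^ (n + t) ∣ (a.subst σ : ℂ⟦X⟧) - a)
    (h' : PowerSeries.X ^ (m + t) ∣ (b.subst σ : ℂ⟦X⟧) - b) :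
    HasConjugate a b (m + t) := by
  obtain ⟨ρ, hρ, hρ1, hρa, hρσ⟩ := exists_subst_eq_self ha hn ht hσ h
  refine ⟨ρ, hρ, hρ1 ▸ hσ1, hρa, ?_⟩
  obtain ⟨m, rfl⟩ := Nat.exists_eq_succ_of_ne_zero hm
  have h1 := X_pow_dvd_subst_sub_subst_of_dvd hρ hσ hρσ hb
  rw [show m + (t + 1) = m.succ + t by omega] at h1
  have := dvd_add h1 h'
  rwa [sub_add_sub_cancel] at this

/-- The inversion formula: the contact of conjugate arcs, in excess of the orders of the
coordinates, does not change when the two coordinates are exchanged. -/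
theorem hasConjugate_swap {a b : ℂ⟦X⟧} {n m t : ℕ} (ha : a.order = n) (hn : n ≠ 0)
    (hb : b.order = m) (hm : m ≠ 0) (ht : t ≠ 0) :
    HasConjugate a b (m + t) ↔ HasConjugate b a (n + t) := by
  constructor
  · rintro ⟨σ, h0, h1, h2, h3⟩
    exact hasConjugate_of_dvd hb hm hn (X_pow_dvd_iff_le_order.mpr ha.ge) ht h0 h1 h3
      (by rw [h2, sub_self]; exact dvd_zero _)
  · rintro ⟨σ, h0, h1, h2, h3⟩
    exact hasConjugate_of_dvd ha hn hm (X_pow_dvd_iff_le_order.mpr hb.ge) ht h0 h1 h3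
      (by rw [h2, sub_self]; exact dvd_zero _)

/-- If `a = 0` is not tangent to the arc, that is if `ord a ≤ ord b`, the coordinate-free contact
is the one measured over a fixed `a`. -/
theorem hasApproxConjugate_iff {a b : ℂ⟦X⟧} {n t : ℕ} (ha : a.order = n) (hn : n ≠ 0)
    (hb : PowerSeries.X ^ n ∣ b) (ht : t ≠ 0) :
    HasApproxConjugate a b (n + t) ↔ HasConjugate a b (n + t) := by
  constructor
  · rintro ⟨σ, h0, h1, h2, h3⟩
    exact hasConjugate_of_dvd ha hn hn hb ht h0 h1 h2 h3
  · rintro ⟨σ, h0, h1, h2, h3⟩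
    exact ⟨σ, h0, h1, by rw [h2, sub_self]; exact dvd_zero _, h3⟩

/-- A uniformizer is preserved only by series with `σ'(0) = 1`, so a smooth arc transverse to
`a = 0` has no conjugates. -/
theorem coeff_one_eq_one_of_order_eq_one {a σ : ℂ⟦X⟧} (ha : a.order = 1)
    (hσ : PowerSeries.constantCoeff σ = 0) (h : a.subst σ = a) : PowerSeries.coeff 1 σ = 1 := by
  obtain ⟨w, hw, hw0⟩ := exists_eq_X_pow_mul_of_order_eq (n := 1) (by simpa using ha)
  have hs := PowerSeries.HasSubst.of_constantCoeff_zero' hσ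
  have h1 : PowerSeries.X ^ 1 ∣ σ - PowerSeries.X := by
    rw [pow_one, PowerSeries.X_dvd_iff, map_sub, hσ, PowerSeries.constantCoeff_X, sub_zero]
  have h2 := X_pow_dvd_subst_sub_subst hσ PowerSeries.constantCoeff_X h1 w
  rw [PowerSeries.X_subst, pow_one, PowerSeries.X_dvd_iff, map_sub, sub_eq_zero] at h2
  rw [hw, pow_one, PowerSeries.subst_mul hs, PowerSeries.subst_X hs] at h
  obtain ⟨e, rfl⟩ := PowerSeries.X_dvd_iff.mpr hσ
  rw [mul_assoc] at h
  have h3 := congrArg PowerSeries.constantCoeff (mul_left_cancel₀ PowerSeries.X_ne_zero h)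
  rw [map_mul, h2] at h3
  rw [← zero_add 1, PowerSeries.coeff_succ_X_mul, PowerSeries.coeff_zero_eq_constantCoeff_apply]
  exact mul_right_cancel₀ hw0 (h3.trans (one_mul _).symm)

theorem not_hasConjugate_of_order_eq_one {a b : ℂ⟦X⟧} (ha : a.order = 1) (K : ℕ) :
    ¬ HasConjugate a b K := by
  rintro ⟨σ, h0, h1, h2, -⟩
  exact h1 (coeff_one_eq_one_of_order_eq_one ha h0 h2)

/-- An arc with `ord a > 1` has conjugates, and they vanish to the same order as the arc. -/
theorem hasConjugate_of_X_pow_dvd {a b : ℂ⟦X⟧} {n m : ℕ} (ha : a.order = n) (hn : 1 < n)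
    (hb : PowerSeries.X ^ m ∣ b) : HasConjugate a b m := by
  have hn0 : n ≠ 0 := by omega
  obtain ⟨w, hw, -⟩ := exists_eq_X_pow_mul_of_order_eq ha
  have hζ := Complex.isPrimitiveRoot_exp n hn0
  set ζ := Complex.exp (2 * Real.pi * Complex.I / n)
  set σ : ℂ⟦X⟧ := PowerSeries.X * PowerSeries.C ζ with hσ
  have h0 : PowerSeries.constantCoeff σ = 0 := by simp [hσ]
  have hs := PowerSeries.HasSubst.of_constantCoeff_zero' h0
  have h1 : PowerSeries.X ^ 1 ∣ σ - PowerSeries.X := by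
    rw [pow_one, PowerSeries.X_dvd_iff, map_sub, h0, PowerSeries.constantCoeff_X, sub_zero]
  have h2 := X_pow_dvd_subst_sub_subst h0 PowerSeries.constantCoeff_X h1 w
  rw [PowerSeries.X_subst] at h2
  have hσ1 : PowerSeries.coeff 1 σ = ζ := by
    rw [hσ, ← zero_add 1, PowerSeries.coeff_succ_X_mul,
        PowerSeries.coeff_zero_eq_constantCoeff_apply, PowerSeries.constantCoeff_C]
  have h3 : PowerSeries.X ^ (n + 1) ∣ (a.subst σ : ℂ⟦X⟧) - a := by
    have e : (a.subst σ : ℂ⟦X⟧) - a = PowerSeries.X ^ n * ((w.subst σ : ℂ⟦X⟧) - w) := by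
      rw [hw, PowerSeries.subst_mul hs, PowerSeries.subst_pow hs, PowerSeries.subst_X hs, hσ,
        mul_pow, ← map_pow, hζ.pow_eq_one, map_one, mul_one, mul_sub]
    rw [e, pow_add]
    exact mul_dvd_mul_left _ h2
  obtain ⟨ρ, hρ, hρ1, hρa, -⟩ := exists_subst_eq_self ha hn0 one_ne_zero h0 h3
  refine ⟨ρ, hρ, ?_, hρa, dvd_sub (X_pow_dvd_subst hρ hb) hb⟩
  rw [hρ1, hσ1]
  exact hζ.ne_one hn

/-! ### Free and satellite points -/

/-- The type of the point in direction `d` of the exceptional curve of the blow-up of a point `p`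
with coordinates `(u, v)`. Here `true` stands for a satellite point, near which
the exceptional curves are `u v = 0`, and `false` for a free point, near which only `u = 0` is
exceptional; `s` is the type of `p`. -/
noncomputable def isSatelliteStep (s : Bool) : OnePoint ℂ → Bool
  | OnePoint.infty => true
  | OnePoint.some c => s && decide (c = 0)

/-- The type of the last point of the sequence of infinitely near points with directions `l`, if
the first point has type `s`. -/
noncomputable def endsSatellite : Bool → List (OnePoint ℂ) → Bool
  | s, [] => s
  | s, d :: l => endsSatellite (isSatelliteStep s d) l

theorem endsSatellite_append (s : Bool) (l l' : List (OnePoint ℂ)) :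
    endsSatellite s (l ++ l') = endsSatellite (endsSatellite s l) l' := by
  induction l generalizing s with
  | nil => rfl
  | cons d l ih => exact ih _

theorem blowUpMap_append {A : Type*} [CommRing A] [Algebra ℂ A] (l l' : List (OnePoint ℂ))
    (z : A × A) : blowUpMap (l ++ l') z = blowUpMap l (blowUpMap l' z) := by
  induction l with
  | nil => rfl
  | cons d l ih => exact congrArg (blowUpChart d) ih

theorem continuous_blowUpMap (l : List (OnePoint ℂ)) :
    Continuous (blowUpMap l : ℂ × ℂ → ℂ × ℂ) := by
  induction l with
  | nil => exact continuous_id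
  | cons d l ih =>
    refine Continuous.comp (g := blowUpChart d) ?_ ih
    induction d using OnePoint.rec with
    | infty => exact (continuous_fst.mul continuous_snd).prodMk continuous_fst
    | coe c =>
      exact continuous_fst.prodMk (continuous_fst.mul (continuous_snd.add continuous_const))

theorem blowUpMap_zero (l : List (OnePoint ℂ)) : blowUpMap l ((0, 0) : ℂ × ℂ) = (0, 0) := by
  induction l with
  | nil => rfl
  | cons d l ih =>
    change blowUpChart d (blowUpMap l _) = _
    rw [ih]
    induction d using OnePoint.rec with
    | infty => simp [blowUpChart]
    | coe c => simp [blowUpChart]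

theorem blowUpMap_cons_eq_zero_iff (d : OnePoint ℂ) (l : List (OnePoint ℂ)) (z : ℂ × ℂ) :
    blowUpMap (d :: l) z = (0, 0) ↔ (blowUpMap l z).1 = 0 := by
  change blowUpChart d (blowUpMap l z) = _ ↔ _
  induction d using OnePoint.rec with
  | infty => simp +contextual [blowUpChart]
  | coe c => simp +contextual [blowUpChart]

/-- The local equation of the exceptional curves near a point of type `s`. -/
def exceptionalEquation (s : Bool) (z : ℂ × ℂ) : ℂ := if s then z.1 * z.2 else z.1

theorem eventually_exceptionalEquation_blowUpMap (s : Bool) (l : List (OnePoint ℂ)) :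
    ∀ᶠ z in 𝓝 ((0, 0) : ℂ × ℂ), exceptionalEquation s (blowUpMap l z) = 0 ↔
      exceptionalEquation (endsSatellite s l) z = 0 := by
  induction l generalizing s with
  | nil => exact Filter.Eventually.of_forall fun z => Iff.rfl
  | cons d l ih =>
    have hlim : Filter.Tendsto (blowUpMap l) (𝓝 ((0, 0) : ℂ × ℂ)) (𝓝 (0, 0)) := by
      have := (continuous_blowUpMap l).tendsto (0, 0)
      rwa [blowUpMap_zero] at this
    have hstep : ∀ᶠ w in 𝓝 ((0, 0) : ℂ × ℂ), exceptionalEquation s (blowUpChart d w) = 0 ↔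
        exceptionalEquation (isSatelliteStep s d) w = 0 := by
      induction d using OnePoint.rec with
      | infty =>
        refine Filter.Eventually.of_forall fun w => ?_
        cases s <;> simp [exceptionalEquation, blowUpChart, isSatelliteStep]
        tauto
      | coe c =>
        by_cases hc : c = 0
        · refine Filter.Eventually.of_forall fun w => ?_
          cases s <;> simp [exceptionalEquation, blowUpChart, isSatelliteStep, hc]
        · have : ∀ᶠ w in 𝓝 ((0, 0) : ℂ × ℂ), w.2 + c ≠ 0 := by
            have hcont : ContinuousAt (fun w : ℂ × ℂ => w.2 + c) (0, 0) :=
              (continuous_snd.add continuous_const).continuousAt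
            exact hcont.eventually_ne (by simpa using hc)
          filter_upwards [this] with w hw
          cases s <;> simp [exceptionalEquation, blowUpChart, isSatelliteStep, hc, hw]
    filter_upwards [ih (isSatelliteStep s d), hlim.eventually hstep] with z h1 h2
    exact h2.trans h1

/-- The origin of the plane is no exceptional point, hence the direction of the first
blow-up always leads to a free point. -/
theorem isFreePoint_cons_iff (d : OnePoint ℂ) (l : List (OnePoint ℂ)) :
    IsFreePoint (d :: l) ↔ endsSatellite false l = false := by
  have key := eventually_exceptionalEquation_blowUpMap false l
  have hiff : IsFreePoint (d :: l) ↔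
      ∀ᶠ z in 𝓝 ((0, 0) : ℂ × ℂ), exceptionalEquation (endsSatellite false l) z = 0 → z.1 = 0 := by
    refine Filter.eventually_congr (key.mono fun z hz => ?_)
    rw [blowUpMap_cons_eq_zero_iff, ← hz]
    simp [exceptionalEquation]
  rw [hiff]
  cases endsSatellite false l with
  | false => simp [exceptionalEquation]
  | true =>
    simp only [exceptionalEquation, if_true, Bool.true_eq_false, iff_false]
    intro h
    have hlim : Filter.Tendsto (fun x : ℂ => (x, (0 : ℂ))) (𝓝[≠] 0) (𝓝 (0, 0)) :=
      ((continuous_id.prodMk continuous_const).tendsto (0 : ℂ)).mono_left nhdsWithin_le_nhds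
    obtain ⟨x, hx, hx0⟩ := ((hlim.eventually h).and self_mem_nhdsWithin).exists
    exact hx0 (hx (mul_zero _))

/-! ### Multiplicities of the strict transforms -/

/-- After `i` of the blow-ups with directions `l` the strict transform of the arc is smooth and
transverse to the only exceptional curve through its centre.  Here `s` is the type of the first
centre and `z` is the arc in the last chart. -/
def IsResolvedStage (s : Bool) (l : List (OnePoint ℂ)) (z : ℂ⟦X⟧ × ℂ⟦X⟧) (i : ℕ) : Prop :=
  endsSatellite s (l.take i) = false ∧ (blowUpMap (l.drop i) z).1.order = 1

/-- The sum of the multiplicities of the strict transforms at the points that are blown up: the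
multiplicity at a point is the order of the equation of the exceptional curve of its blow-up. -/
noncomputable def multiplicitySum (z : ℂ⟦X⟧ × ℂ⟦X⟧) : List (OnePoint ℂ) → ℕ
  | [] => 0
  | _ :: l => (blowUpMap l z).1.order.toNat + multiplicitySum z l

theorem isLeast_isResolvedStage_cons {s : Bool} {d : OnePoint ℂ} {l : List (OnePoint ℂ)}
    {z : ℂ⟦X⟧ × ℂ⟦X⟧} {L : ℕ} (h0 : ¬ IsResolvedStage s (d :: l) z 0)
    (h : IsLeast {i | IsResolvedStage (isSatelliteStep s d) l z i} L) :
    IsLeast {i | IsResolvedStage s (d :: l) z i} (L + 1) := by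
  refine ⟨h.1, fun i hi => ?_⟩
  cases i with
  | zero => exact absurd hi h0
  | succ i => exact Nat.succ_le_succ (h.2 hi)

theorem dvd_blowUpMap {A : Type*} [CommRing A] [Algebra ℂ A] {π : A} {z : A × A} (h1 : π ∣ z.1)
    (h2 : π ∣ z.2) (l : List (OnePoint ℂ)) : π ∣ (blowUpMap l z).1 ∧ π ∣ (blowUpMap l z).2 := by
  induction l with
  | nil => exact ⟨h1, h2⟩
  | cons d l ih =>
    induction d using OnePoint.rec with
    | infty => exact ⟨ih.1.mul_right _, ih.1⟩
    | coe c => exact ⟨ih.1, ih.1.mul_right _⟩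

theorem blowUpMap_infty_cons {A : Type*} [CommRing A] [Algebra ℂ A] (l : List (OnePoint ℂ))
    (z : A × A) : blowUpMap (OnePoint.infty :: l) z
      = ((blowUpMap l z).1 * (blowUpMap l z).2, (blowUpMap l z).1) := rfl

theorem blowUpMap_coe_cons {A : Type*} [CommRing A] [Algebra ℂ A] (c : ℂ) (l : List (OnePoint ℂ))
    (z : A × A) : blowUpMap ((c : OnePoint ℂ) :: l) z
      = ((blowUpMap l z).1, (blowUpMap l z).1 * ((blowUpMap l z).2 + algebraMap ℂ A c)) := rfl

theorem order_add_algebraMap {b : ℂ⟦X⟧} (hb : PowerSeries.X ∣ b) {c : ℂ} (hc : c ≠ 0) :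
    (b + algebraMap ℂ ℂ⟦X⟧ c).order = 0 := by
  refine PowerSeries.order_zero_of_unit (PowerSeries.isUnit_iff_constantCoeff.mpr ?_)
  rw [map_add, PowerSeries.X_dvd_iff.mp hb, zero_add]
  simpa [PowerSeries.algebraMap_apply] using hc

theorem ne_zero_of_X_dvd_of_order_eq {a : ℂ⟦X⟧} {n : ℕ} (h : PowerSeries.X ∣ a)
    (ha : a.order = n) : n ≠ 0 := by
  rw [← pow_one PowerSeries.X, X_pow_dvd_iff_le_order, ha] at h
  have : 1 ≤ n := by exact_mod_cast h
  omega

/-- The sum of the multiplicities in terms of the contact of conjugate arcs, for a sequence of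
blow-ups that starts at a free point.  Here `n` is the order of the first coordinate, `L` is the
number of blow-ups in the minimal resolution, and `K` is the maximal contact, or `0` if `n = 1` and
there are no conjugates. -/
def FreeContactFormula (l : List (OnePoint ℂ)) (z : ℂ⟦X⟧ × ℂ⟦X⟧) : Prop :=
  ∃ n L K : ℕ, (blowUpMap l z).1.order = n ∧ L ≤ l.length ∧
    IsLeast {i | IsResolvedStage false l z i} L ∧
    multiplicitySum z l + L + 1 = K + n + l.length ∧
    ((n = 1 ∧ K = 0 ∧ L = 0) ∨
      (1 < n ∧ HasConjugate (blowUpMap l z).1 (blowUpMap l z).2 K ∧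
        ¬ HasConjugate (blowUpMap l z).1 (blowUpMap l z).2 (K + 1)))

/-- The sum of the multiplicities in terms of the contact of conjugate arcs, for a sequence of
blow-ups that starts at a satellite point. The number `t` is the maximal contact in excess of
the order of the second coordinate, or `0` if there is no such excess. -/
def SatelliteContactFormula (l : List (OnePoint ℂ)) (z : ℂ⟦X⟧ × ℂ⟦X⟧) : Prop :=
  ∃ n m t L : ℕ, (blowUpMap l z).1.order = n ∧ (blowUpMap l z).2.order = m ∧ L ≤ l.length ∧
    IsLeast {i | IsResolvedStage true l z i} L ∧
    multiplicitySum z l + L + 1 = n + m + t + l.length ∧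
    (t = 0 ∨ HasConjugate (blowUpMap l z).1 (blowUpMap l z).2 (m + t)) ∧
    ¬ HasConjugate (blowUpMap l z).1 (blowUpMap l z).2 (m + t + 1)

theorem not_isResolvedStage_true_zero (l : List (OnePoint ℂ)) (z : ℂ⟦X⟧ × ℂ⟦X⟧) :
    ¬ IsResolvedStage true l z 0 := by
  rintro ⟨h, -⟩
  rw [List.take_zero] at h
  exact Bool.noConfusion h

theorem not_isResolvedStage_false_zero {l : List (OnePoint ℂ)} {z : ℂ⟦X⟧ × ℂ⟦X⟧} {n : ℕ}
    (h : (blowUpMap l z).1.order = n) (hn : n ≠ 1) : ¬ IsResolvedStage false l z 0 := by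
  rintro ⟨-, h1⟩
  rw [List.drop_zero, h] at h1
  exact hn (by exact_mod_cast h1)

theorem freeContactFormula_nil {z : ℂ⟦X⟧ × ℂ⟦X⟧} (hz : z.1.order = 1) :
    FreeContactFormula [] z :=
  ⟨1, 0, 0, by simpa [blowUpMap] using hz, le_rfl, ⟨⟨rfl, hz⟩, fun _ _ => Nat.zero_le _⟩, rfl,
    Or.inl ⟨rfl, rfl, rfl⟩⟩

theorem freeContactFormula_coe_cons {z : ℂ⟦X⟧ × ℂ⟦X⟧} {l : List (OnePoint ℂ)}
    (c : ℂ) (h : FreeContactFormula l z) : FreeContactFormula ((c : OnePoint ℂ) :: l) z := by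
  obtain ⟨n, L, K, ha, hL, hleast, hsum, hcase⟩ := h
  have hsum' : multiplicitySum z ((c : OnePoint ℂ) :: l) = n + multiplicitySum z l := by
    simp [multiplicitySum, ha]
  have hlen : ((c : OnePoint ℂ) :: l).length = l.length + 1 := rfl
  rcases hcase with ⟨rfl, rfl, rfl⟩ | ⟨hn, hK, hK'⟩
  · refine ⟨1, 0, 0, ha, Nat.zero_le _, ⟨⟨rfl, ?_⟩, fun _ _ => Nat.zero_le _⟩, ?_,
      Or.inl ⟨rfl, rfl, rfl⟩⟩
    · simpa [blowUpMap_coe_cons] using ha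
    · omega
  · refine ⟨n, L + 1, K + n, ha, ?_,
      isLeast_isResolvedStage_cons (not_isResolvedStage_false_zero ha (by omega)) hleast, ?_,
      Or.inr ⟨hn, ?_, ?_⟩⟩
    · omega
    · omega
    · rw [blowUpMap_coe_cons]
      exact (hasConjugate_mul_add_iff c ha).mpr hK
    · rw [blowUpMap_coe_cons, add_right_comm]
      exact fun h => hK' ((hasConjugate_mul_add_iff c ha).mp h)

/-- The effect of the blow-up in the infinite direction on the contact of conjugate arcs. -/
theorem hasConjugate_blowUpChart_infty_iff {a b : ℂ⟦X⟧} {n m t : ℕ} (ha : a.order = n)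
    (hn : n ≠ 0) (hb : b.order = m) (hm : m ≠ 0) (ht : t ≠ 0) :
    HasConjugate (a * b) a (n + t) ↔ HasConjugate a b (m + t) := by
  have hab : (a * b).order = (n + m : ℕ) := by rw [PowerSeries.order_mul, ha, hb]; push_cast; rfl
  rw [hasConjugate_swap hab (by omega) ha hn ht]
  have := hasConjugate_mul_add_iff (b := b) (K := m + t) 0 ha
  rw [map_zero, add_zero] at this
  rw [← this]
  congr! 1
  omega

theorem freeContactFormula_infty_cons {z : ℂ⟦X⟧ × ℂ⟦X⟧} (h1 : PowerSeries.X ∣ z.1)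
    (h2 : PowerSeries.X ∣ z.2) {l : List (OnePoint ℂ)} (h : SatelliteContactFormula l z) :
    FreeContactFormula (OnePoint.infty :: l) z := by
  obtain ⟨n, m, t, L, ha, hb, hL, hleast, hsum, ht, ht'⟩ := h
  obtain ⟨hX1, hX2⟩ := dvd_blowUpMap h1 h2 l
  have hn := ne_zero_of_X_dvd_of_order_eq hX1 ha
  have hm := ne_zero_of_X_dvd_of_order_eq hX2 hb
  have hsum' : multiplicitySum z (OnePoint.infty :: l) = n + multiplicitySum z l := by
    simp [multiplicitySum, ha]
  have hlen : ((OnePoint.infty : OnePoint ℂ) :: l).length = l.length + 1 := rfl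
  have hab : (blowUpMap (OnePoint.infty :: l) z).1.order = (n + m : ℕ) := by
    rw [blowUpMap_infty_cons, PowerSeries.order_mul, ha, hb]; push_cast; rfl
  refine ⟨n + m, L + 1, n + t, hab, by omega,
    isLeast_isResolvedStage_cons (not_isResolvedStage_false_zero hab (by omega)) hleast,
    by omega, Or.inr ⟨by omega, ?_, ?_⟩⟩
  · rw [blowUpMap_infty_cons] at hab ⊢
    rcases Nat.eq_zero_or_pos t with rfl | htpos
    · exact hasConjugate_of_X_pow_dvd hab (by omega) (X_pow_dvd_iff_le_order.mpr ha.ge)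
    · exact (hasConjugate_blowUpChart_infty_iff ha hn hb hm htpos.ne').mpr
        (ht.resolve_left htpos.ne')
  · rw [blowUpMap_infty_cons, add_assoc, hasConjugate_blowUpChart_infty_iff ha hn hb hm (by omega)]
    exact ht'

theorem satelliteContactFormula_infty_cons {z : ℂ⟦X⟧ × ℂ⟦X⟧} (h1 : PowerSeries.X ∣ z.1)
    (h2 : PowerSeries.X ∣ z.2) {l : List (OnePoint ℂ)} (h : SatelliteContactFormula l z) :
    SatelliteContactFormula (OnePoint.infty :: l) z := by
  obtain ⟨n, m, t, L, ha, hb, hL, hleast, hsum, ht, ht'⟩ := h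
  obtain ⟨hX1, hX2⟩ := dvd_blowUpMap h1 h2 l
  have hn := ne_zero_of_X_dvd_of_order_eq hX1 ha
  have hm := ne_zero_of_X_dvd_of_order_eq hX2 hb
  have hsum' : multiplicitySum z (OnePoint.infty :: l) = n + multiplicitySum z l := by
    simp [multiplicitySum, ha]
  have hlen : ((OnePoint.infty : OnePoint ℂ) :: l).length = l.length + 1 := rfl
  have hab : (blowUpMap (OnePoint.infty :: l) z).1.order = (n + m : ℕ) := by
    rw [blowUpMap_infty_cons, PowerSeries.order_mul, ha, hb]; push_cast; rfl
  refine ⟨n + m, n, t, L + 1, hab, ha, by omega,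
    isLeast_isResolvedStage_cons (not_isResolvedStage_true_zero _ _) hleast,
    by omega, ?_, ?_⟩
  · rw [blowUpMap_infty_cons]
    rcases Nat.eq_zero_or_pos t with rfl | htpos
    · exact Or.inl rfl
    · exact Or.inr ((hasConjugate_blowUpChart_infty_iff ha hn hb hm htpos.ne').mpr
        (ht.resolve_left htpos.ne'))
  · rw [blowUpMap_infty_cons, add_assoc, hasConjugate_blowUpChart_infty_iff ha hn hb hm (by omega)]
    exact ht'

theorem satelliteContactFormula_zero_cons {z : ℂ⟦X⟧ × ℂ⟦X⟧} {l : List (OnePoint ℂ)}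
    (h : SatelliteContactFormula l z) :
    SatelliteContactFormula (((0 : ℂ) : OnePoint ℂ) :: l) z := by
  obtain ⟨n, m, t, L, ha, hb, hL, hleast, hsum, ht, ht'⟩ := h
  have hsum' : multiplicitySum z (((0 : ℂ) : OnePoint ℂ) :: l) = n + multiplicitySum z l := by
    simp [multiplicitySum, ha]
  have hlen : (((0 : ℂ) : OnePoint ℂ) :: l).length = l.length + 1 := rfl
  have hstep : isSatelliteStep true ((0 : ℂ) : OnePoint ℂ) = true := by simp [isSatelliteStep]
  rw [← hstep] at hleast
  refine ⟨n, n + m, t, L + 1, ha, ?_, by omega,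
    isLeast_isResolvedStage_cons (not_isResolvedStage_true_zero _ _) hleast, by omega, ?_, ?_⟩
  · rw [blowUpMap_coe_cons, map_zero, add_zero, PowerSeries.order_mul, ha, hb]; push_cast; rfl
  · refine ht.imp_right fun h => ?_
    rw [blowUpMap_coe_cons, show n + m + t = m + t + n by ring]
    exact (hasConjugate_mul_add_iff 0 ha).mpr h
  · rw [blowUpMap_coe_cons, show n + m + t + 1 = m + t + 1 + n by ring]
    exact fun h => ht' ((hasConjugate_mul_add_iff 0 ha).mp h)

theorem satelliteContactFormula_coe_cons {z : ℂ⟦X⟧ × ℂ⟦X⟧} (h1 : PowerSeries.X ∣ z.1)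
    (h2 : PowerSeries.X ∣ z.2) {l : List (OnePoint ℂ)} {c : ℂ} (hc : c ≠ 0)
    (h : FreeContactFormula l z) : SatelliteContactFormula ((c : OnePoint ℂ) :: l) z := by
  obtain ⟨n, L, K, ha, hL, hleast, hsum, hcase⟩ := h
  obtain ⟨hX1, hX2⟩ := dvd_blowUpMap h1 h2 l
  have hsum' : multiplicitySum z ((c : OnePoint ℂ) :: l) = n + multiplicitySum z l := by
    simp [multiplicitySum, ha]
  have hlen : ((c : OnePoint ℂ) :: l).length = l.length + 1 := rfl
  have hstep : isSatelliteStep true (c : OnePoint ℂ) = false := by simp [isSatelliteStep, hc]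
  rw [← hstep] at hleast
  refine ⟨n, n, K, L + 1, ha, ?_, by omega,
    isLeast_isResolvedStage_cons (not_isResolvedStage_true_zero _ _) hleast, by omega, ?_, ?_⟩
  · rw [blowUpMap_coe_cons, PowerSeries.order_mul, ha, order_add_algebraMap hX2 hc, add_zero]
  · rcases hcase with ⟨-, rfl, -⟩ | ⟨-, hK, -⟩
    · exact Or.inl rfl
    · rw [blowUpMap_coe_cons, add_comm n K]
      exact Or.inr ((hasConjugate_mul_add_iff c ha).mpr hK)
  · rw [blowUpMap_coe_cons, show n + K + 1 = K + 1 + n by ring]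
    rcases hcase with ⟨rfl, -, -⟩ | ⟨-, -, hK⟩
    · exact not_hasConjugate_of_order_eq_one (by simpa using ha) _
    · exact fun h => hK ((hasConjugate_mul_add_iff c ha).mp h)

/-- The contact formulas, by induction on the blow-ups, for an arc `z` that is transverse to the
last exceptional curve at a free point. -/
theorem contactFormula {z : ℂ⟦X⟧ × ℂ⟦X⟧} (h1 : z.1.order = 1) (h2 : PowerSeries.X ∣ z.2)
    (l : List (OnePoint ℂ)) :
    (endsSatellite false l = false → FreeContactFormula l z) ∧
      (endsSatellite true l = false → SatelliteContactFormula l z) := by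
  have hX : PowerSeries.X ∣ z.1 := by
    rw [← pow_one PowerSeries.X, X_pow_dvd_iff_le_order, h1]; exact le_rfl
  induction l with
  | nil => exact ⟨fun _ => freeContactFormula_nil h1, fun h => Bool.noConfusion h⟩
  | cons d l ih =>
    induction d using OnePoint.rec with
    | infty =>
      exact ⟨fun h => freeContactFormula_infty_cons hX h2 (ih.2 h),
        fun h => satelliteContactFormula_infty_cons hX h2 (ih.2 h)⟩
    | coe c =>
      refine ⟨fun h => freeContactFormula_coe_cons c (ih.1 h), fun h => ?_⟩
      by_cases hc : c = 0
      · subst hc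
        refine satelliteContactFormula_zero_cons (ih.2 ?_)
        simpa [endsSatellite, isSatelliteStep] using h
      · refine satelliteContactFormula_coe_cons hX h2 hc (ih.1 ?_)
        simpa [endsSatellite, isSatelliteStep, hc] using h

/-! ### Change of coordinates -/

theorem hasSubst_curve {γ : ℂ⟦X⟧ × ℂ⟦X⟧} (h1 : PowerSeries.X ∣ γ.1) (h2 : PowerSeries.X ∣ γ.2) :
    MvPowerSeries.HasSubst (![γ.1, γ.2] : Fin 2 → MvPowerSeries Unit ℂ) := by
  refine MvPowerSeries.hasSubst_of_constantCoeff_zero fun s => ?_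
  fin_cases s
  · exact PowerSeries.X_dvd_iff.mp h1
  · exact PowerSeries.X_dvd_iff.mp h2

theorem coeff_substCurve {γ : ℂ⟦X⟧ × ℂ⟦X⟧} (h1 : PowerSeries.X ∣ γ.1) (h2 : PowerSeries.X ∣ γ.2)
    (h : MvPowerSeries (Fin 2) ℂ) (k : ℕ) :
    (fun d : Fin 2 →₀ ℕ => MvPowerSeries.coeff d h *
        PowerSeries.coeff k (γ.1 ^ d 0 * γ.2 ^ d 1)).HasFiniteSupport ∧
      PowerSeries.coeff k (substCurve h γ)
        = finsum fun d : Fin 2 →₀ ℕ => MvPowerSeries.coeff d h *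
          PowerSeries.coeff k (γ.1 ^ d 0 * γ.2 ^ d 1) := by
  have hs := hasSubst_curve h1 h2
  have e : (fun d : Fin 2 →₀ ℕ => MvPowerSeries.coeff d h *
        PowerSeries.coeff k (γ.1 ^ d 0 * γ.2 ^ d 1))
      = fun d : Fin 2 →₀ ℕ => MvPowerSeries.coeff d h • MvPowerSeries.coeff (Finsupp.single () k)
          (d.prod fun s e => ((![γ.1, γ.2] : Fin 2 → MvPowerSeries Unit ℂ) s) ^ e) := by
    funext d
    rw [Finsupp.prod_fintype _ _ (fun i => pow_zero _), Fin.prod_univ_two]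
    rfl
  rw [e]
  exact ⟨MvPowerSeries.coeff_subst_finite hs h _, MvPowerSeries.coeff_subst hs h _⟩

theorem substCurve_subst {γ : ℂ⟦X⟧ × ℂ⟦X⟧} (h1 : PowerSeries.X ∣ γ.1)
    (h2 : PowerSeries.X ∣ γ.2) {σ : ℂ⟦X⟧} (hσ : PowerSeries.constantCoeff σ = 0)
    (h : MvPowerSeries (Fin 2) ℂ) :
    ((substCurve h γ).subst σ : ℂ⟦X⟧) = substCurve h (γ.1.subst σ, γ.2.subst σ) := by
  have hs := PowerSeries.HasSubst.of_constantCoeff_zero' hσ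
  unfold substCurve
  rw [PowerSeries.subst, MvPowerSeries.subst_comp_subst_apply (hasSubst_curve h1 h2) hs.const]
  congr 1
  funext i
  fin_cases i <;> rfl

/-- The leading term of the difference of the values of a series in two variables at two arcs that
agree modulo `X ^ k` is given by the linear part of the series. -/
theorem coeff_substCurve_sub {γ γ' : ℂ⟦X⟧ × ℂ⟦X⟧} (h1 : PowerSeries.X ∣ γ.1)
    (h2 : PowerSeries.X ∣ γ.2) (h1' : PowerSeries.X ∣ γ'.1) (h2' : PowerSeries.X ∣ γ'.2) {k : ℕ}
    (hk1 : PowerSeries.X ^ k ∣ γ'.1 - γ.1) (hk2 : PowerSeries.X ^ k ∣ γ'.2 - γ.2)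
    (h : MvPowerSeries (Fin 2) ℂ) {j : ℕ} (hj : j ≤ k) :
    PowerSeries.coeff j (substCurve h γ' - substCurve h γ)
      = MvPowerSeries.coeff (Finsupp.single 0 1) h * PowerSeries.coeff j (γ'.1 - γ.1)
        + MvPowerSeries.coeff (Finsupp.single 1 1) h * PowerSeries.coeff j (γ'.2 - γ.2) := by
  obtain ⟨hf, he⟩ := coeff_substCurve h1 h2 h j
  obtain ⟨hf', he'⟩ := coeff_substCurve h1' h2' h j
  have hpow : ∀ {x x' : ℂ⟦X⟧}, PowerSeries.X ∣ x → PowerSeries.X ∣ x' →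
      PowerSeries.X ^ k ∣ x' - x → ∀ m, PowerSeries.X ^ (1 + k) ∣ x' ^ (m + 2) - x ^ (m + 2) := by
    intro x x' hx hx' hd m
    have hx0 := PowerSeries.X_dvd_iff.mp hx
    have hx0' := PowerSeries.X_dvd_iff.mp hx'
    have := X_pow_dvd_subst_sub_subst_of_dvd hx0' hx0 hd (n := 1)
      (a := PowerSeries.X ^ (m + 2)) (pow_dvd_pow _ (by omega))
    have hs := PowerSeries.HasSubst.of_constantCoeff_zero' hx0
    have hs' := PowerSeries.HasSubst.of_constantCoeff_zero' hx0'
    rwa [PowerSeries.subst_pow hs, PowerSeries.subst_pow hs', PowerSeries.subst_X hs,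
      PowerSeries.subst_X hs'] at this
  -- Monomials that are not linear do not contribute.
  have hzero : ∀ m n : ℕ, (m, n) ≠ (1, 0) → (m, n) ≠ (0, 1) →
      PowerSeries.X ^ (1 + k) ∣ γ'.1 ^ m * γ'.2 ^ n - γ.1 ^ m * γ.2 ^ n := by
    intro m n hm hn
    rcases m with _ | _ | m
    · rcases n with _ | _ | n
      · simp
      · exact absurd rfl hn
      · simpa using hpow h2 h2' hk2 n
    · rcases n with _ | n
      · exact absurd rfl hm
      · have e : γ'.1 ^ (0 + 1) * γ'.2 ^ (n + 1) - γ.1 ^ (0 + 1) * γ.2 ^ (n + 1)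
            = γ'.2 ^ (n + 1) * (γ'.1 - γ.1) + γ.1 * (γ'.2 ^ (n + 1) - γ.2 ^ (n + 1)) := by ring
        rw [e, pow_add, pow_one]
        exact dvd_add (mul_dvd_mul (h2'.trans (dvd_pow_self _ (Nat.succ_ne_zero n))) hk1)
          (mul_dvd_mul h1 (hk2.trans (sub_dvd_pow_sub_pow _ _ _)))
    · rcases n with _ | n
      · simpa using hpow h1 h1' hk1 m
      · have e : γ'.1 ^ (m + 2) * γ'.2 ^ (n + 1) - γ.1 ^ (m + 2) * γ.2 ^ (n + 1)
            = γ'.2 ^ (n + 1) * (γ'.1 ^ (m + 2) - γ.1 ^ (m + 2))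
              + γ.1 ^ (m + 2) * (γ'.2 ^ (n + 1) - γ.2 ^ (n + 1)) := by ring
        rw [e]
        refine dvd_add (Dvd.dvd.mul_left (hpow h1 h1' hk1 m) _) ?_
        rw [pow_add, pow_one]
        exact mul_dvd_mul (h1.trans (dvd_pow_self _ (Nat.succ_ne_zero _)))
          (hk2.trans (sub_dvd_pow_sub_pow _ _ _))
  rw [map_sub, he, he', ← finsum_sub_distrib hf' hf]
  have hne : (Finsupp.single 0 1 : Fin 2 →₀ ℕ) ≠ Finsupp.single 1 1 := by
    intro h
    have := DFunLike.congr_fun h 0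
    simp at this
  rw [finsum_eq_sum_of_support_subset (s := {Finsupp.single 0 1, Finsupp.single 1 1})]
  · rw [Finset.sum_pair hne]
    simp [mul_sub]
  · intro d hd
    rw [Function.mem_support] at hd
    by_contra hd'
    simp only [Finset.coe_insert, Finset.coe_singleton, Set.mem_insert_iff,
      Set.mem_singleton_iff, not_or] at hd'
    have h3 : (d 0, d 1) ≠ (1, 0) := by
      intro h
      refine hd'.1 (Finsupp.ext fun i => ?_)
      rw [Prod.mk.injEq] at h
      fin_cases i <;> simp [h]
    have h4 : (d 0, d 1) ≠ (0, 1) := by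
      intro h
      refine hd'.2 (Finsupp.ext fun i => ?_)
      rw [Prod.mk.injEq] at h
      fin_cases i <;> simp [h]
    refine hd ?_
    rw [← mul_sub, ← map_sub, PowerSeries.X_pow_dvd_iff.mp (hzero _ _ h3 h4) j (by omega),
      mul_zero]

/-- In formal coordinates arcs agree to the same order as in the given ones. -/
theorem X_pow_dvd_substCurve_sub_iff {x y : MvPowerSeries (Fin 2) ℂ}
    (hxy : MvPowerSeries.coeff (Finsupp.single 0 1) x * MvPowerSeries.coeff (Finsupp.single 1 1) y
      - MvPowerSeries.coeff (Finsupp.single 1 1) x * MvPowerSeries.coeff (Finsupp.single 0 1) y ≠ 0)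
    {γ γ' : ℂ⟦X⟧ × ℂ⟦X⟧} (h1 : PowerSeries.X ∣ γ.1)
    (h2 : PowerSeries.X ∣ γ.2) (h1' : PowerSeries.X ∣ γ'.1) (h2' : PowerSeries.X ∣ γ'.2) (k : ℕ) :
    (PowerSeries.X ^ k ∣ substCurve x γ' - substCurve x γ ∧
        PowerSeries.X ^ k ∣ substCurve y γ' - substCurve y γ) ↔
      (PowerSeries.X ^ k ∣ γ'.1 - γ.1 ∧ PowerSeries.X ^ k ∣ γ'.2 - γ.2) := by
  constructor
  · induction k with
    | zero => simp
    | succ k ih =>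
      rintro ⟨hx, hy⟩
      have hle : (PowerSeries.X : ℂ⟦X⟧) ^ k ∣ PowerSeries.X ^ (k + 1) :=
        pow_dvd_pow _ (Nat.le_succ k)
      obtain ⟨hk1, hk2⟩ := ih ⟨hle.trans hx, hle.trans hy⟩
      have ex := coeff_substCurve_sub h1 h2 h1' h2' hk1 hk2 x le_rfl
      have ey := coeff_substCurve_sub h1 h2 h1' h2' hk1 hk2 y le_rfl
      rw [PowerSeries.X_pow_dvd_iff.mp hx k (Nat.lt_succ_self k)] at ex
      rw [PowerSeries.X_pow_dvd_iff.mp hy k (Nat.lt_succ_self k)] at ey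
      -- Cramer's rule.
      have z1 : PowerSeries.coeff k (γ'.1 - γ.1) = 0 := by
        refine (mul_eq_zero.mp ?_).resolve_left hxy
        linear_combination MvPowerSeries.coeff (Finsupp.single 1 1) x * ey
          - MvPowerSeries.coeff (Finsupp.single 1 1) y * ex
      have z2 : PowerSeries.coeff k (γ'.2 - γ.2) = 0 := by
        refine (mul_eq_zero.mp ?_).resolve_left hxy
        linear_combination MvPowerSeries.coeff (Finsupp.single 0 1) y * ex
          - MvPowerSeries.coeff (Finsupp.single 0 1) x * ey
      constructor
      · refine PowerSeries.X_pow_dvd_iff.mpr fun m hm => ?_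
        rcases Nat.lt_succ_iff_lt_or_eq.mp hm with h | rfl
        · exact PowerSeries.X_pow_dvd_iff.mp hk1 m h
        · exact z1
      · refine PowerSeries.X_pow_dvd_iff.mpr fun m hm => ?_
        rcases Nat.lt_succ_iff_lt_or_eq.mp hm with h | rfl
        · exact PowerSeries.X_pow_dvd_iff.mp hk2 m h
        · exact z2
  · rintro ⟨hk1, hk2⟩
    constructor <;>
    · refine PowerSeries.X_pow_dvd_iff.mpr fun m hm => ?_
      rw [coeff_substCurve_sub h1 h2 h1' h2' hk1 hk2 _ hm.le,
        PowerSeries.X_pow_dvd_iff.mp hk1 m hm, PowerSeries.X_pow_dvd_iff.mp hk2 m hm]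
      simp

theorem substCurve_zero {h : MvPowerSeries (Fin 2) ℂ} (h0 : MvPowerSeries.constantCoeff h = 0) :
    substCurve h (0, 0) = 0 := by
  have hz : PowerSeries.constantCoeff (substCurve h (0, 0)) = 0 :=
    MvPowerSeries.constantCoeff_subst_eq_zero (hasSubst_curve (dvd_zero _) (dvd_zero _))
      (fun s => by fin_cases s <;> rfl) h0
  have e := substCurve_subst (γ := (0, 0)) (dvd_zero _) (dvd_zero _)
    (map_zero (PowerSeries.constantCoeff (R := ℂ))) h
  have e0 : ((0 : ℂ⟦X⟧).subst (0 : ℂ⟦X⟧) : ℂ⟦X⟧) = 0 :=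
    PowerSeries.subst_zero_of_constantCoeff_zero (map_zero _)
  have e1 : ((substCurve h (0, 0)).subst (0 : ℂ⟦X⟧) : ℂ⟦X⟧) = 0 :=
    PowerSeries.subst_zero_of_constantCoeff_zero hz
  simp only [e0] at e
  exact e.symm.trans e1

/-- The number `mult` is the multiplicity of the branch in the given coordinates as well. -/
theorem PuiseuxCoordinates.X_pow_dvd_iff {γ : ℂ⟦X⟧ × ℂ⟦X⟧} (P : PuiseuxCoordinates γ)
    (h1 : PowerSeries.X ∣ γ.1) (h2 : PowerSeries.X ∣ γ.2) (k : ℕ) :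
    (PowerSeries.X ^ k ∣ γ.1 ∧ PowerSeries.X ^ k ∣ γ.2) ↔ k ≤ P.mult := by
  have key := X_pow_dvd_substCurve_sub_iff P.linear_part_invertible (γ := (0, 0)) (γ' := γ)
    (dvd_zero _) (dvd_zero _) h1 h2 k
  rw [substCurve_zero P.constantCoeff_x₀, substCurve_zero P.constantCoeff_y₀] at key
  simp only [sub_zero] at key
  rw [← key, P.x₀_eq, X_pow_dvd_iff_le_order, X_pow_dvd_iff_le_order, PowerSeries.order_X_pow,
    Nat.cast_le]
  exact ⟨fun h => h.1, fun h => ⟨h, le_trans (by exact_mod_cast h) P.tangent.le⟩⟩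

theorem PuiseuxCoordinates.hasApproxConjugate_iff {γ : ℂ⟦X⟧ × ℂ⟦X⟧} (P : PuiseuxCoordinates γ)
    (h1 : PowerSeries.X ∣ γ.1) (h2 : PowerSeries.X ∣ γ.2) (N : ℕ) :
    HasApproxConjugate γ.1 γ.2 N ↔ HasApproxConjugate (PowerSeries.X ^ P.mult) P.φ N := by
  rw [← P.x₀_eq]
  refine exists_congr fun σ => and_congr_right fun h0 => and_congr_right fun _ => ?_
  have hd : ∀ a : ℂ⟦X⟧, PowerSeries.X ∣ a → PowerSeries.X ∣ (a.subst σ : ℂ⟦X⟧) := fun a ha => by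
    have := X_pow_dvd_subst h0 (n := 1) (a := a) (by rwa [pow_one])
    rwa [pow_one] at this
  rw [PuiseuxCoordinates.φ, substCurve_subst h1 h2 h0, substCurve_subst h1 h2 h0]
  exact (X_pow_dvd_substCurve_sub_iff P.linear_part_invertible
    (γ' := (γ.1.subst σ, γ.2.subst σ)) h1 h2 (hd _ h1) (hd _ h2) N).symm

/-! ### Characteristic exponents -/

/-- For `a = X ^ n` the conjugates are obtained by multiplying the parameter by roots of unity. -/
theorem hasConjugate_X_pow_iff {n : ℕ} (hn : n ≠ 0) (φ : ℂ⟦X⟧) (K : ℕ) :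
    HasConjugate (PowerSeries.X ^ n) φ K ↔
      ∃ d, 1 < d ∧ d ∣ n ∧ ∀ k < K, PowerSeries.coeff k φ ≠ 0 → d ∣ k := by
  constructor
  · rintro ⟨σ, h0, h1, h2, h3⟩
    have hs := PowerSeries.HasSubst.of_constantCoeff_zero' h0
    obtain ⟨e, rfl⟩ := PowerSeries.X_dvd_iff.mpr h0
    rw [PowerSeries.subst_pow hs, PowerSeries.subst_X hs, mul_pow] at h2
    have he : e ^ n = 1 :=
      mul_left_cancel₀ (pow_ne_zero n PowerSeries.X_ne_zero) (h2.trans (mul_one _).symm)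
    set ζ := PowerSeries.constantCoeff e with hζ
    have hζn : ζ ^ n = 1 := by rw [hζ, ← map_pow, he, map_one]
    have hζ0 : ζ ≠ 0 := by
      rintro h; rw [h, zero_pow hn] at hζn; exact zero_ne_one hζn
    have heC : e = PowerSeries.C ζ := by
      have : (0 : ℂ⟦X⟧) ∣ e - PowerSeries.C ζ := by
        refine dvd_sub_of_dvd_pow_sub_pow hn ?_ ?_ ?_
        · rw [PowerSeries.constantCoeff_C]
        · rwa [PowerSeries.constantCoeff_C]
        · rw [he, ← map_pow, hζn, map_one, sub_self]
      exact sub_eq_zero.mp (zero_dvd_iff.mp this)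
    have hζ1 : ζ ≠ 1 := by
      rwa [← zero_add 1, PowerSeries.coeff_succ_X_mul,
        PowerSeries.coeff_zero_eq_constantCoeff_apply] at h1
    have hdvd : orderOf ζ ∣ n := orderOf_dvd_of_pow_eq_one hζn
    refine ⟨orderOf ζ, ?_, hdvd, fun k hk hφ => ?_⟩
    · have := Nat.pos_of_dvd_of_pos hdvd (Nat.pos_of_ne_zero hn)
      have := mt orderOf_eq_one_iff.mp hζ1
      omega
    · have h4 := PowerSeries.X_pow_dvd_iff.mp h3 k hk
      have e1 : PowerSeries.X * e = ζ • (PowerSeries.X : ℂ⟦X⟧) := by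
        rw [heC, mul_comm, PowerSeries.smul_eq_C_mul]
      rw [e1, ← PowerSeries.rescale_eq_subst, map_sub, PowerSeries.coeff_rescale, sub_eq_zero]
        at h4
      exact orderOf_dvd_of_pow_eq_one (mul_right_cancel₀ hφ (h4.trans (one_mul _).symm))
  · rintro ⟨d, hd, hdn, hK⟩
    have hζ := Complex.isPrimitiveRoot_exp d (by omega)
    set ζ := Complex.exp (2 * Real.pi * Complex.I / d)
    have h0 : PowerSeries.constantCoeff (ζ • (PowerSeries.X : ℂ⟦X⟧)) = 0 := by simp
    have hs := PowerSeries.HasSubst.of_constantCoeff_zero' h0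
    refine ⟨ζ • (PowerSeries.X : ℂ⟦X⟧), h0, ?_, ?_, ?_⟩
    · simpa using hζ.ne_one hd
    · rw [PowerSeries.subst_pow hs, PowerSeries.subst_X hs, smul_pow,
        (hζ.pow_eq_one_iff_dvd n).mpr hdn, one_smul]
    · refine PowerSeries.X_pow_dvd_iff.mpr fun k hk => ?_
      rw [← PowerSeries.rescale_eq_subst, map_sub, PowerSeries.coeff_rescale]
      by_cases hφ : PowerSeries.coeff k φ = 0
      · rw [hφ]; simp
      · rw [(hζ.pow_eq_one_iff_dvd k).mpr (hK k hk hφ), one_mul, sub_self]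

theorem minExponent_eq_top_iff {φ : ℂ⟦X⟧} {d : ℕ} :
    minExponent φ d = ⊤ ↔ ∀ k, PowerSeries.coeff k φ ≠ 0 → d ∣ k := by
  simp [minExponent]

/-- If it is finite, the minimal exponent is attained. -/
theorem minExponent_spec {φ : ℂ⟦X⟧} {d : ℕ} (h : minExponent φ d ≠ ⊤) :
    ∃ k, minExponent φ d = (k : ℕ) ∧ PowerSeries.coeff k φ ≠ 0 ∧ ¬ d ∣ k ∧
      ∀ j < k, PowerSeries.coeff j φ ≠ 0 → d ∣ j := by
  classical
  have hex : ∃ k, PowerSeries.coeff k φ ≠ 0 ∧ ¬ d ∣ k := by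
    by_contra hc
    push Not at hc
    exact h (minExponent_eq_top_iff.mpr hc)
  refine ⟨Nat.find hex, le_antisymm ?_ ?_, (Nat.find_spec hex).1, (Nat.find_spec hex).2, ?_⟩
  · exact iInf₂_le (Nat.find hex) (Nat.find_spec hex)
  · exact le_iInf₂ fun k hk => by exact_mod_cast Nat.find_min' hex hk
  · intro j hj hφ
    by_contra hd
    exact Nat.find_min hex hj ⟨hφ, hd⟩

theorem charGcd_succ_dvd (n : ℕ) (φ : ℂ⟦X⟧) (i : ℕ) : charGcd n φ (i + 2) ∣ charGcd n φ (i + 1) :=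
  Nat.gcd_dvd_right _ _

theorem charGcd_dvd (n : ℕ) (φ : ℂ⟦X⟧) (i : ℕ) : charGcd n φ (i + 1) ∣ n := by
  induction i with
  | zero => exact dvd_rfl
  | succ i ih => exact (charGcd_succ_dvd n φ i).trans ih

theorem minExponent_le_of_dvd {φ : ℂ⟦X⟧} {d d' : ℕ} (h : d' ∣ d) :
    minExponent φ d ≤ minExponent φ d' :=
  biInf_mono fun _ hk => ⟨hk.1, fun hd => hk.2 (h.trans hd)⟩

theorem charExponent_succ (n : ℕ) (φ : ℂ⟦X⟧) (i : ℕ) :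
    charExponent n φ (i + 1) = minExponent φ (charGcd n φ (i + 1)) :=
  if_neg (Nat.succ_ne_zero i)

theorem charExponent_mono {n : ℕ} {φ : ℂ⟦X⟧} {i j : ℕ} (hij : i ≤ j) :
    charExponent n φ (i + 1) ≤ charExponent n φ (j + 1) := by
  induction hij with
  | refl => exact le_rfl
  | step _ ih =>
    refine ih.trans ?_
    rw [charExponent_succ, charExponent_succ]
    exact minExponent_le_of_dvd (charGcd_succ_dvd n φ _)

/-- The integers `rᵢ` decrease strictly until `kᵢ = ∞`. -/
theorem exists_charExponent_eq_top {n : ℕ} (hn : n ≠ 0) (φ : ℂ⟦X⟧) :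
    ∃ g, charExponent n φ (g + 1) = ⊤ := by
  by_contra hc
  push Not at hc
  have hlt : ∀ i, charGcd n φ (i + 1) + i ≤ n := by
    intro i
    induction i with
    | zero => exact le_rfl
    | succ i ih =>
      obtain ⟨k, hk, -, hd, -⟩ := minExponent_spec (charExponent_succ n φ i ▸ hc i)
      have hpos : 0 < charGcd n φ (i + 1) :=
        Nat.pos_of_dvd_of_pos (charGcd_dvd n φ i) (Nat.pos_of_ne_zero hn)
      have hlt : charGcd n φ (i + 2) < charGcd n φ (i + 1) := by
        refine lt_of_le_of_ne (Nat.le_of_dvd hpos (charGcd_succ_dvd n φ i)) fun h => hd ?_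
        rw [← h, charGcd, hk, ENat.toNat_natCast]
        exact Nat.gcd_dvd_left _ _
      change charGcd n φ (i + 2) + (i + 1) ≤ n
      omega
  have := hlt n
  have hpos : 0 < charGcd n φ (n + 1) :=
    Nat.pos_of_dvd_of_pos (charGcd_dvd n φ n) (Nat.pos_of_ne_zero hn)
  omega

theorem branchNewtonData_one (φ : ℂ⟦X⟧) : (branchNewtonData 1 φ).g = 0 ∧
    (branchNewtonData 1 φ).k 0 = 0 := by
  refine ⟨Nat.sInf_eq_zero.mpr (Or.inl ?_), rfl⟩
  rw [Set.mem_ofPred_eq, charExponent_succ]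
  exact minExponent_eq_top_iff.mpr fun k _ => one_dvd k

/-- The last characteristic exponent is the first one up to which all exponents are coprime: it is
the maximal order of contact of the branch with its conjugates. -/
theorem branchNewtonData_k_g {n : ℕ} (hn : 1 < n) {φ : ℂ⟦X⟧} {K : ℕ}
    (h : ∃ d, 1 < d ∧ d ∣ n ∧ ∀ k < K, PowerSeries.coeff k φ ≠ 0 → d ∣ k)
    (h' : ¬ ∃ d, 1 < d ∧ d ∣ n ∧ ∀ k < K + 1, PowerSeries.coeff k φ ≠ 0 → d ∣ k) :
    (branchNewtonData n φ).k (branchNewtonData n φ).g = K := by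
  have hn0 : n ≠ 0 := by omega
  have hne : {g | charExponent n φ (g + 1) = ⊤}.Nonempty := exists_charExponent_eq_top hn0 φ
  set g := sInf {g | charExponent n φ (g + 1) = ⊤} with hg
  have htop : charExponent n φ (g + 1) = ⊤ := Nat.sInf_mem hne
  have hfin : ∀ i < g, charExponent n φ (i + 1) ≠ ⊤ := fun i hi => Nat.notMem_of_lt_sInf hi
  change (charExponent n φ g).toNat = K
  rw [charExponent_succ, minExponent_eq_top_iff] at htop
  have hpos : ∀ i, 0 < charGcd n φ (i + 1) := fun i =>
    Nat.pos_of_dvd_of_pos (charGcd_dvd n φ i) (Nat.pos_of_ne_zero hn0)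
  -- The exponents have no common divisor with `n`.
  have hr : charGcd n φ (g + 1) = 1 := by
    by_contra hne1
    have := hpos g
    exact h' ⟨_, by omega, charGcd_dvd n φ g, fun k _ hk => htop k hk⟩
  obtain ⟨m, hm⟩ : ∃ m, g = m + 1 := by
    refine Nat.exists_eq_succ_of_ne_zero fun h0 => ?_
    rw [h0] at hr
    change n = 1 at hr
    omega
  rw [hm] at hr hfin ⊢
  have hfm := hfin m (Nat.lt_succ_self m)
  rw [charExponent_succ] at hfm
  obtain ⟨k, hk, hkφ, hkd, hkmin⟩ := minExponent_spec hfm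
  rw [charExponent_succ, hk, ENat.toNat_natCast]
  refine le_antisymm ?_ ?_
  · -- `r_g > 1` divides all exponents below `k_g`.
    by_contra hlt
    push Not at hlt
    refine h' ⟨charGcd n φ (m + 1), ?_, charGcd_dvd n φ m, fun j hj => hkmin j (by omega)⟩
    have := hpos m
    have : charGcd n φ (m + 1) ≠ 1 := fun h1 => hkd (by rw [h1]; exact one_dvd k)
    omega
  · -- A common divisor of `n` and of the exponents up to `k_g` divides `r_{g+1} = 1`.
    by_contra hlt
    push Not at hlt
    obtain ⟨d, hd1, hdn, hd⟩ := h
    have hdvd : ∀ i ≤ m + 1, d ∣ charGcd n φ (i + 1) := by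
      intro i
      induction i with
      | zero => exact fun _ => hdn
      | succ i ih =>
        intro hi
        have hfi := hfin i (by omega)
        have hmono := charExponent_mono (n := n) (φ := φ) (show i ≤ m by omega)
        rw [charExponent_succ] at hfi
        rw [charExponent_succ, charExponent_succ] at hmono
        obtain ⟨j, hj, hjφ, -, -⟩ := minExponent_spec hfi
        rw [hj, hk, Nat.cast_le] at hmono
        change d ∣ Nat.gcd (minExponent φ (charGcd n φ (i + 1))).toNat (charGcd n φ (i + 1))
        rw [hj, ENat.toNat_natCast]
        exact Nat.dvd_gcd (hd j (by omega) hjφ) (ih (by omega))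
    have := hdvd (m + 1) le_rfl
    rw [hr, Nat.dvd_one] at this
    omega

/-! ### The relative canonical divisor -/

/-- The sum of the orders along `π` of the equations of the exceptional curves of all blow-ups with
directions `l`, evaluated at a point `z` of the last chart.  For `π = u` and `z = (u, v)` this is
the order of the Jacobian of `blowUpMap l`; for an arc `z` and `π` the parameter it is the sum of
the multiplicities of the strict transforms. -/
noncomputable def exceptionalSum {A : Type*} [CommRing A] [Algebra ℂ A] (π : A) (z : A × A) :
    List (OnePoint ℂ) → ℕ∞
  | [] => 0
  | _ :: l => emultiplicity π (blowUpMap l z).1 + exceptionalSum π z l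

section

variable {A B : Type*} [CommRing A] [Algebra ℂ A] [CommRing B] [Algebra ℂ B]

theorem exceptionalSum_append_singleton (π : A) (z : A × A) (l : List (OnePoint ℂ))
    (d : OnePoint ℂ) :
    exceptionalSum π z (l ++ [d]) = exceptionalSum π (blowUpChart d z) l + emultiplicity π z.1 := by
  induction l with
  | nil => exact add_comm _ _
  | cons d' l ih =>
    change emultiplicity π (blowUpMap (l ++ [d]) z).1 + exceptionalSum π z (l ++ [d]) = _
    rw [ih, blowUpMap_append, ← add_assoc]
    rfl

theorem emultiplicity_add_algebraMap {π b : A} (hπ : Prime π) (hb : π ∣ b) {c : ℂ} (hc : c ≠ 0) :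
    emultiplicity π (b + algebraMap ℂ A c) = 0 := by
  refine emultiplicity_eq_zero.mpr fun h => hπ.not_isUnit ?_
  exact isUnit_of_dvd_unit ((dvd_add_right hb).mp h) (hc.isUnit.map (algebraMap ℂ A))

variable [IsDomain A] [IsDomain B]

/-- The orders of the exceptional equations depend only on the orders of the coordinates in the
last chart, and only on the first of them if the last point is free. -/
theorem emultiplicity_blowUpMap_eq {π : A} {ρ : B} (hπ : Prime π) (hρ : Prime ρ) {z : A × A}
    {w : B × B} (hz1 : π ∣ z.1) (hz2 : π ∣ z.2) (hw1 : ρ ∣ w.1) (hw2 : ρ ∣ w.2)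
    (h1 : emultiplicity π z.1 = emultiplicity ρ w.1) (s : Bool) (l : List (OnePoint ℂ))
    (h2 : endsSatellite s l = true → emultiplicity π z.2 = emultiplicity ρ w.2) :
    emultiplicity π (blowUpMap l z).1 = emultiplicity ρ (blowUpMap l w).1 ∧
      (s = true → emultiplicity π (blowUpMap l z).2 = emultiplicity ρ (blowUpMap l w).2) := by
  induction l generalizing s with
  | nil => exact ⟨h1, h2⟩
  | cons d l ih =>
    obtain ⟨e1, e2⟩ := ih (isSatelliteStep s d) h2
    induction d using OnePoint.rec with
    | infty =>
      rw [blowUpMap_infty_cons, blowUpMap_infty_cons]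
      exact ⟨by rw [emultiplicity_mul hπ, emultiplicity_mul hρ, e1, e2 rfl], fun _ => e1⟩
    | coe c =>
      rw [blowUpMap_coe_cons, blowUpMap_coe_cons]
      refine ⟨e1, fun hs => ?_⟩
      rw [emultiplicity_mul hπ, emultiplicity_mul hρ, e1]
      by_cases hc : c = 0
      · subst hc
        rw [map_zero, map_zero, add_zero, add_zero, e2 (by simp [isSatelliteStep, hs])]
      · rw [emultiplicity_add_algebraMap hπ (dvd_blowUpMap hz1 hz2 l).2 hc,
          emultiplicity_add_algebraMap hρ (dvd_blowUpMap hw1 hw2 l).2 hc]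

theorem exceptionalSum_eq {π : A} {ρ : B} (hπ : Prime π) (hρ : Prime ρ) {z : A × A}
    {w : B × B} (hz1 : π ∣ z.1) (hz2 : π ∣ z.2) (hw1 : ρ ∣ w.1) (hw2 : ρ ∣ w.2)
    (h1 : emultiplicity π z.1 = emultiplicity ρ w.1) (s : Bool) (l : List (OnePoint ℂ))
    (h2 : endsSatellite s l = true → emultiplicity π z.2 = emultiplicity ρ w.2) :
    exceptionalSum π z l = exceptionalSum ρ w l := by
  induction l generalizing s with
  | nil => rfl
  | cons d l ih =>
    exact congrArg₂ _
      (emultiplicity_blowUpMap_eq hπ hρ hz1 hz2 hw1 hw2 h1 (isSatelliteStep s d) l h2).1 (ih _ h2)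

end

theorem exceptionalSum_eq_multiplicitySum {z : ℂ⟦X⟧ × ℂ⟦X⟧} (h1 : z.1.order = 1)
    (h2 : PowerSeries.X ∣ z.2) (s : Bool) (l : List (OnePoint ℂ)) (h : endsSatellite s l = false) :
    ∃ n : ℕ, (blowUpMap l z).1.order = n ∧
      exceptionalSum PowerSeries.X z l = multiplicitySum z l := by
  induction l generalizing s with
  | nil => exact ⟨1, h1, rfl⟩
  | cons d l ih =>
    obtain ⟨n, hn, hl⟩ := ih _ h
    have hd : ∃ m : ℕ, (blowUpMap (d :: l) z).1.order = m := by
      cases s with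
      | false =>
        obtain ⟨m, -, -, hm, -⟩ := (contactFormula h1 h2 (d :: l)).1 h
        exact ⟨m, hm⟩
      | true =>
        obtain ⟨m, -, -, -, hm, -⟩ := (contactFormula h1 h2 (d :: l)).2 h
        exact ⟨m, hm⟩
    obtain ⟨m, hm⟩ := hd
    refine ⟨m, hm, ?_⟩
    change emultiplicity PowerSeries.X (blowUpMap l z).1 + exceptionalSum PowerSeries.X z l
      = (((blowUpMap l z).1.order.toNat + multiplicitySum z l : ℕ) : ℕ∞)
    rw [hl, ← PowerSeries.order_eq_emultiplicity_X, hn, ENat.toNat_natCast, Nat.cast_add]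

/-- The Jacobian determinant of a pair of polynomials in two variables. -/
noncomputable def jacobianDet (z : MvPolynomial (Fin 2) ℂ × MvPolynomial (Fin 2) ℂ) :
    MvPolynomial (Fin 2) ℂ :=
  MvPolynomial.pderiv 0 z.1 * MvPolynomial.pderiv 1 z.2
    - MvPolynomial.pderiv 1 z.1 * MvPolynomial.pderiv 0 z.2

/-- The Jacobian of a chart of a blow-up is up to sign the equation of the exceptional curve. -/
theorem jacobianDet_blowUpChart (d : OnePoint ℂ)
    (z : MvPolynomial (Fin 2) ℂ × MvPolynomial (Fin 2) ℂ) :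
    jacobianDet (blowUpChart d z) = z.1 * jacobianDet z ∨
      jacobianDet (blowUpChart d z) = -(z.1 * jacobianDet z) := by
  induction d using OnePoint.rec with
  | infty =>
    right
    simp only [jacobianDet, blowUpChart, Derivation.leibniz, smul_eq_mul]
    ring
  | coe c =>
    left
    simp only [jacobianDet, blowUpChart, Derivation.leibniz, smul_eq_mul, map_add,
      Derivation.map_algebraMap]
    ring

theorem emultiplicity_jacobianDet_blowUpMap {π : MvPolynomial (Fin 2) ℂ} (hπ : Prime π)
    (l : List (OnePoint ℂ)) (z : MvPolynomial (Fin 2) ℂ × MvPolynomial (Fin 2) ℂ) :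
    emultiplicity π (jacobianDet (blowUpMap l z))
      = exceptionalSum π z l + emultiplicity π (jacobianDet z) := by
  induction l with
  | nil => exact (zero_add _).symm
  | cons d l ih =>
    have h : emultiplicity π (jacobianDet (blowUpMap (d :: l) z))
        = emultiplicity π ((blowUpMap l z).1 * jacobianDet (blowUpMap l z)) := by
      rcases jacobianDet_blowUpChart d (blowUpMap l z) with h | h
      · exact congrArg _ h
      · exact (congrArg _ h).trans (emultiplicity_neg _ _)
    rw [h, emultiplicity_mul hπ, ih, ← add_assoc]
    rfl

namespace ExceptionalDivisor

theorem logDiscrepancy_eq_exceptionalSum (E : ExceptionalDivisor) :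
    E.logDiscrepancy = exceptionalSum (MvPolynomial.X 0)
      ((MvPolynomial.X 0, MvPolynomial.X 1) : MvPolynomial (Fin 2) ℂ × MvPolynomial (Fin 2) ℂ)
      (E.centers ++ [((0 : ℂ) : OnePoint ℂ)]) + 1 := by
  have h := emultiplicity_jacobianDet_blowUpMap (MvPolynomial.X_prime (R := ℂ) (i := (0 : Fin 2)))
    (E.centers ++ [((0 : ℂ) : OnePoint ℂ)]) (MvPolynomial.X 0, MvPolynomial.X 1)
  have h1 : jacobianDet (MvPolynomial.X 0, MvPolynomial.X 1) = 1 := by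
    simp [jacobianDet, MvPolynomial.pderiv_X]
  rw [h1, emultiplicity_of_isUnit_right
    (MvPolynomial.X_prime (R := ℂ) (i := (0 : Fin 2))).not_isUnit isUnit_one, add_zero] at h
  exact congrArg (· + 1) h

namespace Curvette

variable {E : ExceptionalDivisor}

theorem X_dvd_v (D : E.Curvette) : PowerSeries.X ∣ D.v :=
  PowerSeries.X_dvd_iff.mpr D.constantCoeff_v

theorem X_dvd_u (D : E.Curvette) : PowerSeries.X ∣ D.u := by
  rw [← pow_one PowerSeries.X, X_pow_dvd_iff_le_order, D.order_u]; exact le_rfl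

/-- The log discrepancy is one more than the sum of the multiplicities of the strict transforms of
the blow-down of a curvette. -/
theorem logDiscrepancy_eq (D : E.Curvette) :
    E.logDiscrepancy = (multiplicitySum (D.u, D.v) D.directions : ℕ) + 1 := by
  have hX0 := MvPolynomial.X_prime (R := ℂ) (i := (0 : Fin 2))
  have hX := PowerSeries.X_prime (R := ℂ)
  have hX00 : emultiplicity (MvPolynomial.X 0 : MvPolynomial (Fin 2) ℂ) (MvPolynomial.X 0) = 1 := by
    have := emultiplicity_pow_self hX0.ne_zero hX0.not_isUnit 1
    simpa using this
  have hX01 : emultiplicity (MvPolynomial.X 0 : MvPolynomial (Fin 2) ℂ) (MvPolynomial.X 1) = 0 := by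
    rw [emultiplicity_eq_zero, MvPolynomial.X_dvd_X]
    simp
  have hu : emultiplicity PowerSeries.X D.u = 1 := by
    rw [← PowerSeries.order_eq_emultiplicity_X, D.order_u]
  have hfree := D.isFree
  rw [logDiscrepancy_eq_exceptionalSum, exceptionalSum_append_singleton]
  congr 1
  have key : exceptionalSum PowerSeries.X (D.u, D.v) D.directions
      = exceptionalSum (MvPolynomial.X 0 : MvPolynomial (Fin 2) ℂ)
        (blowUpChart ((0 : ℂ) : OnePoint ℂ) (MvPolynomial.X 0, MvPolynomial.X 1)) E.centers
        + emultiplicity (MvPolynomial.X 0 : MvPolynomial (Fin 2) ℂ) (MvPolynomial.X 0) := by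
    rw [directions, exceptionalSum_append_singleton, hu, hX00]
    congr 1
    cases hc : E.centers with
    | nil => rfl
    | cons d l =>
      rw [hc, List.cons_append, isFreePoint_cons_iff, endsSatellite_append] at hfree
      have hfree' : isSatelliteStep (endsSatellite false l) D.point = false := hfree
      induction hp : D.point using OnePoint.rec with
      | infty => rw [hp] at hfree'; exact Bool.noConfusion hfree'
      | coe c =>
        rw [hp] at hfree'
        have hz1 : PowerSeries.X ∣ (blowUpChart (c : OnePoint ℂ) (D.u, D.v)).1 := D.X_dvd_u
        have hz2 : PowerSeries.X ∣ (blowUpChart (c : OnePoint ℂ) (D.u, D.v)).2 :=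
          D.X_dvd_u.mul_right _
        have hw1 : (MvPolynomial.X 0 : MvPolynomial (Fin 2) ℂ) ∣
            (blowUpChart ((0 : ℂ) : OnePoint ℂ) (MvPolynomial.X 0, MvPolynomial.X 1)).1 := dvd_rfl
        have hw2 : (MvPolynomial.X 0 : MvPolynomial (Fin 2) ℂ) ∣
            (blowUpChart ((0 : ℂ) : OnePoint ℂ) (MvPolynomial.X 0, MvPolynomial.X 1)).2 :=
          Dvd.intro _ rfl
        have h1 : emultiplicity PowerSeries.X (blowUpChart (c : OnePoint ℂ) (D.u, D.v)).1
            = emultiplicity (MvPolynomial.X 0 : MvPolynomial (Fin 2) ℂ)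
              (blowUpChart ((0 : ℂ) : OnePoint ℂ) (MvPolynomial.X 0, MvPolynomial.X 1)).1 :=
          hu.trans hX00.symm
        have h2 : endsSatellite false l = true →
            emultiplicity PowerSeries.X (blowUpChart (c : OnePoint ℂ) (D.u, D.v)).2
            = emultiplicity (MvPolynomial.X 0 : MvPolynomial (Fin 2) ℂ)
              (blowUpChart ((0 : ℂ) : OnePoint ℂ) (MvPolynomial.X 0, MvPolynomial.X 1)).2 := by
          intro hs
          have hc0 : c ≠ 0 := by
            rintro rfl
            simp [isSatelliteStep, hs] at hfree'
          change emultiplicity PowerSeries.X (D.u * (D.v + algebraMap ℂ ℂ⟦X⟧ c))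
            = emultiplicity (MvPolynomial.X 0 : MvPolynomial (Fin 2) ℂ)
              (MvPolynomial.X 0 * (MvPolynomial.X 1 + algebraMap ℂ _ 0))
          rw [emultiplicity_mul hX, emultiplicity_mul hX0, hu,
            emultiplicity_add_algebraMap hX D.X_dvd_v hc0, map_zero, add_zero, add_zero, hX00, hX01,
            add_zero]
        exact congrArg₂ _
          (emultiplicity_blowUpMap_eq hX hX0 hz1 hz2 hw1 hw2 h1 false l h2).1
          (exceptionalSum_eq hX hX0 hz1 hz2 hw1 hw2 h1 false l h2)
  rw [← key]
  obtain ⟨d, l, hdl⟩ : ∃ d l, D.directions = d :: l := by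
    unfold directions
    cases E.centers with
    | nil => exact ⟨_, _, rfl⟩
    | cons d l => exact ⟨_, _, rfl⟩
  change IsFreePoint D.directions at hfree
  rw [hdl, isFreePoint_cons_iff] at hfree
  obtain ⟨n, hn, hsum⟩ := exceptionalSum_eq_multiplicitySum (z := (D.u, D.v)) D.order_u
    D.X_dvd_v false l hfree
  rw [hdl]
  change emultiplicity PowerSeries.X (blowUpMap l (D.u, D.v)).1
      + exceptionalSum PowerSeries.X (D.u, D.v) l
    = (((blowUpMap l (D.u, D.v)).1.order.toNat + multiplicitySum (D.u, D.v) l : ℕ) : ℕ∞)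
  rw [hsum, ← PowerSeries.order_eq_emultiplicity_X, hn, ENat.toNat_natCast, Nat.cast_add]

end Curvette

end ExceptionalDivisor

/-! ### From the strict transforms to the Newton data -/

/-- The multiplicity of an arc is the order of the exceptional equation after one blow-up. -/
theorem X_pow_dvd_blowUpChart_iff {z : ℂ⟦X⟧ × ℂ⟦X⟧} {n : ℕ} (h : z.1.order = n)
    (d : OnePoint ℂ) (k : ℕ) :
    (PowerSeries.X ^ k ∣ (blowUpChart d z).1 ∧ PowerSeries.X ^ k ∣ (blowUpChart d z).2) ↔
      k ≤ n := by
  rw [← Nat.cast_le (α := ℕ∞), ← h, ← X_pow_dvd_iff_le_order]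
  induction d using OnePoint.rec with
  | infty => exact ⟨fun h => h.2, fun h => ⟨h.mul_right _, h⟩⟩
  | coe c => exact ⟨fun h => h.1, fun h => ⟨h, h.mul_right _⟩⟩

theorem hasApproxConjugate_blowUpChart_iff {z : ℂ⟦X⟧ × ℂ⟦X⟧} {n K : ℕ} (h : z.1.order = n)
    (hn : n ≠ 0) (hK : K ≠ 0) (d : OnePoint ℂ) :
    HasApproxConjugate (blowUpChart d z).1 (blowUpChart d z).2 (n + K) ↔
      HasConjugate z.1 z.2 K := by
  have key : ∀ c : ℂ, HasApproxConjugate z.1 (z.1 * (z.2 + algebraMap ℂ ℂ⟦X⟧ c)) (n + K) ↔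
      HasConjugate z.1 z.2 K := fun c => by
    rw [hasApproxConjugate_iff h hn ((X_pow_dvd_iff_le_order.mpr h.ge).mul_right _) hK,
      add_comm n K]
    exact hasConjugate_mul_add_iff c h
  induction d using OnePoint.rec with
  | infty =>
    have := key 0
    rw [map_zero, add_zero] at this
    exact hasApproxConjugate_comm.trans this
  | coe c => exact key c

namespace ExceptionalDivisor.Curvette

variable {E : ExceptionalDivisor}

theorem isResolvedAt_zero_iff (D : E.Curvette) {d : OnePoint ℂ} {l : List (OnePoint ℂ)}
    (h : D.directions = d :: l) {n : ℕ} (hn : (blowUpMap l (D.u, D.v)).1.order = n)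
    (hX : PowerSeries.X ∣ (blowUpMap l (D.u, D.v)).1)
    (hX2 : PowerSeries.X ∣ (blowUpMap l (D.u, D.v)).2) :
    D.IsResolvedAt 0 ↔ n = 1 := by
  have hn0 := ne_zero_of_X_dvd_of_order_eq hX hn
  have hst : D.strictTransform 0 = blowUpChart d (blowUpMap l (D.u, D.v)) := by
    rw [strictTransform, h]; rfl
  simp only [IsResolvedAt, lt_irrefl, false_and, or_false, true_and]
  rw [hst]
  generalize blowUpMap l (D.u, D.v) = z at hn hX hX2
  have hz2 : 1 ≤ z.2.order := by
    rw [← Nat.cast_one, ← X_pow_dvd_iff_le_order, pow_one]; exact hX2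
  have hne : (n : ℕ∞) + z.2.order ≠ 1 := by
    intro h1
    have h2 : (n : ℕ∞) + 1 ≤ 1 := (add_le_add_right hz2 _).trans h1.le
    have : n + 1 ≤ 1 := by exact_mod_cast h2
    omega
  induction d using OnePoint.rec with
  | infty =>
    simp only [blowUpChart, PowerSeries.order_mul, hn, hne, false_or]
    norm_cast
  | coe c =>
    simp only [blowUpChart, PowerSeries.order_mul, hn]
    constructor
    · rintro (h1 | h1)
      · exact_mod_cast h1
      · have h2 : (n : ℕ∞) ≤ 1 := h1 ▸ le_self_add
        have : n ≤ 1 := by exact_mod_cast h2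
        omega
    · rintro rfl
      exact Or.inl rfl

theorem isResolvedAt_succ_iff (D : E.Curvette) {d : OnePoint ℂ} {l : List (OnePoint ℂ)}
    (h : D.directions = d :: l) (i : ℕ) :
    D.IsResolvedAt (i + 1) ↔ IsResolvedStage false l (D.u, D.v) i := by
  simp only [IsResolvedAt, Nat.succ_ne_zero, false_and, false_or, Nat.succ_pos, true_and,
    strictTransform, h, List.drop_succ_cons, List.take_succ_cons, isFreePoint_cons_iff,
    IsResolvedStage]
  exact and_comm

/-- The sum of the multiplicities of the strict transforms in terms of the multiplicity `n` of
the blow-down and of the maximal contact `K` with its conjugates. -/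
theorem multiplicitySum_eq (D : E.Curvette) :
    ∃ n K : ℕ,
      (∀ k, (PowerSeries.X ^ k ∣ D.blowDown.1 ∧ PowerSeries.X ^ k ∣ D.blowDown.2) ↔ k ≤ n) ∧
      multiplicitySum (D.u, D.v) D.directions + 1 = K + n + D.extraBlowUps ∧
      ((n = 1 ∧ K = 0) ∨
        (1 < n ∧ n < K ∧ HasApproxConjugate D.blowDown.1 D.blowDown.2 K ∧
          ¬ HasApproxConjugate D.blowDown.1 D.blowDown.2 (K + 1))) := by
  obtain ⟨d, l, hdl⟩ : ∃ d l, D.directions = d :: l := by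
    unfold directions
    cases E.centers with
    | nil => exact ⟨_, _, rfl⟩
    | cons d l => exact ⟨_, _, rfl⟩
  have hlevel : E.level = l.length + 1 := by
    have : D.directions.length = E.centers.length + 1 := by simp [directions]
    rw [level, ← this, hdl, List.length_cons]
  have hfree : IsFreePoint D.directions := D.isFree
  rw [hdl, isFreePoint_cons_iff] at hfree
  obtain ⟨n, L, K, hn, hL, hleast, hsum, hcase⟩ :=
    (contactFormula (z := (D.u, D.v)) D.order_u D.X_dvd_v l).1 hfree
  obtain ⟨hX1, hX2⟩ := dvd_blowUpMap (z := (D.u, D.v)) D.X_dvd_u D.X_dvd_v l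
  have hn0 := ne_zero_of_X_dvd_of_order_eq hX1 hn
  have hblow : D.blowDown = blowUpChart d (blowUpMap l (D.u, D.v)) := by
    rw [blowDown, strictTransform, hdl]; rfl
  have h0 := D.isResolvedAt_zero_iff hdl hn hX1 hX2
  have hms : multiplicitySum (D.u, D.v) D.directions = n + multiplicitySum (D.u, D.v) l := by
    rw [hdl, multiplicitySum, hn, ENat.toNat_natCast]
  rw [hblow, extraBlowUps, hlevel, hms]
  rcases hcase with ⟨rfl, rfl, rfl⟩ | ⟨hn1, hK, hK'⟩
  · have hres : D.resolutionLength = 0 := Nat.sInf_eq_zero.mpr (Or.inl (h0.mpr rfl))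
    exact ⟨1, 0, X_pow_dvd_blowUpChart_iff hn d, by omega, Or.inl ⟨rfl, rfl⟩⟩
  · have hres : D.resolutionLength = L + 1 := by
      refine IsLeast.csInf_eq ⟨(D.isResolvedAt_succ_iff hdl L).mpr hleast.1, fun i hi => ?_⟩
      cases i with
      | zero => exact absurd (h0.mp hi) (by omega)
      | succ i => exact Nat.succ_le_succ (hleast.2 ((D.isResolvedAt_succ_iff hdl i).mp hi))
    have hKpos : K ≠ 0 := by
      rintro rfl
      exact hK' (hasConjugate_of_X_pow_dvd hn hn1 (by rwa [zero_add, pow_one]))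
    refine ⟨n, n + K, X_pow_dvd_blowUpChart_iff hn d, by omega,
      Or.inr ⟨hn1, by omega, ?_, ?_⟩⟩
    · exact (hasApproxConjugate_blowUpChart_iff hn hn0 hKpos d).mpr hK
    · rw [add_assoc, hasApproxConjugate_blowUpChart_iff hn hn0 (Nat.succ_ne_zero K) d]
      exact hK'

theorem X_dvd_blowDown (D : E.Curvette) :
    PowerSeries.X ∣ D.blowDown.1 ∧ PowerSeries.X ∣ D.blowDown.2 :=
  dvd_blowUpMap (z := (D.u, D.v)) D.X_dvd_u D.X_dvd_v _

theorem multiplicitySum_eq_branchNewtonData (D : E.Curvette) (P : PuiseuxCoordinates D.blowDown) :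
    multiplicitySum (D.u, D.v) D.directions + 1
      = (branchNewtonData P.mult P.φ).k (branchNewtonData P.mult P.φ).g + P.mult
        + D.extraBlowUps := by
  obtain ⟨n, K, hmult, hsum, hcase⟩ := D.multiplicitySum_eq
  obtain ⟨h1, h2⟩ := D.X_dvd_blowDown
  have hn : n = P.mult :=
    le_antisymm ((P.X_pow_dvd_iff h1 h2 n).mp ((hmult n).mpr le_rfl))
      ((hmult P.mult).mp ((P.X_pow_dvd_iff h1 h2 P.mult).mpr le_rfl))
  rw [hsum, ← hn]
  congr 2
  rcases hcase with ⟨rfl, rfl⟩ | ⟨hn1, hK, hc, hc'⟩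
  · rw [(branchNewtonData_one P.φ).1, (branchNewtonData_one P.φ).2]
  · have hφ : PowerSeries.X ^ n ∣ P.φ :=
      X_pow_dvd_iff_le_order.mpr (hn ▸ P.tangent.le)
    have key : ∀ N, n < N → (HasApproxConjugate D.blowDown.1 D.blowDown.2 N ↔
        ∃ d, 1 < d ∧ d ∣ n ∧ ∀ k < N, PowerSeries.coeff k P.φ ≠ 0 → d ∣ k) := by
      intro N hN
      obtain ⟨t, rfl⟩ := Nat.exists_eq_add_of_lt hN
      rw [P.hasApproxConjugate_iff h1 h2, ← hn, add_assoc,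
        PlaneCurve.hasApproxConjugate_iff (PowerSeries.order_X_pow n) (by omega) hφ (by omega),
        hasConjugate_X_pow_iff (by omega)]
    exact (branchNewtonData_k_g hn1 ((key K hK).mp hc)
      (mt (key (K + 1) (by omega)).mpr hc')).symm

end ExceptionalDivisor.Curvette

end PlaneCurve

theorem proposition2p5 (E : PlaneCurve.ExceptionalDivisor) (D : E.Curvette)
    (P : PlaneCurve.PuiseuxCoordinates D.blowDown) :
    E.logDiscrepancy
      = (((E.newtonData D P).k (E.newtonData D P).g + (E.newtonData D P).r 1 : ℕ) : ℕ∞) := by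
  have h := D.multiplicitySum_eq_branchNewtonData P
  rw [D.logDiscrepancy_eq, ← Nat.cast_one, ← Nat.cast_add, h]
  congr 1
  unfold PlaneCurve.ExceptionalDivisor.newtonData
  split_ifs with hs
  · rw [hs, add_zero]
    rfl
  · simp only [PlaneCurve.NewtonData.append, Nat.not_succ_le_self, if_false,
      Nat.le_add_left, if_true]
    exact add_right_comm _ _ _
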